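/- Let $G$ be a group and let $S\subset G$ be a finite generating set with $S=S^{-1}$ and $e\notin S$. Let $\Gamma=\mathrm{Cay}(G,S)$ be the Cayley graph, with vertex set $G$ and an edge $\{g,gs\}$ for all $g\in G$ and $s\in S$. Let $d\ge 2$ be an integer, and suppose that $\Gamma$ has polynomial growth of order $d$, i.e. there is a constant $C_1\ge 1$ such that the ball of radius $n$ about $e$ in the path metric has between $C_1^{-1}n^d$ and $C_1n^d$ elements for every integer $n\ge 1$. For a finite connected set $\Omega\subset G$ of vertices, let $B$ be the set of vertices outside $\Omega$ that are adjacent to a vertex of $\Omega$. The subgraph $(\Omega,B)$ of $\Gamma$ is the finite graph with vertex set $\bar\Omega=\Omega\cup B$ whose edges are the edges of $\Gamma$ that join a vertex of $\Omega$ to a vertex of $\bar\Omega$, with $B$ as its boundary. A real number $\sigma$ is a Steklov eigenvalue of $(\Omega,B)$ if there is a non-zero function $u:\bar\Omega\to\mathbb R$ such that $$\sum_{j\sim i}(u(i)-u(j))=0\ \text{ for } i\in\Omega,\qquad \sum_{j\sim i}(u(i)-u(j))=\sigma\,u(i)\ \text{ for } i\in B,$$ where $\sim$ is adjacency in $(\Omega,B)$.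 There are $|B|$ Steklov eigenvalues, counted with multiplicity (the dimension of the space of such $u$); denote them by $0=\sigma_0(\Omega,B)\le\sigma_1(\Omega,B)\le\dots\le\sigma_{|B|-1}(\Omega,B)$. Then there is a constant $C(\Gamma)>0$ (depending on $\Gamma$ but not on $\Omega$ or $k$) such that for every finite connected $\Omega\subset G$, with $B$ as above, and every integer $0\le k<|B|$, $$\sigma_k(\Omega,B)\le C(\Gamma)\cdot\frac{1}{|B|^{\frac1{d-1}}}\cdot k^{\frac{d+2}{d}}.$$ -/

import Mathlib

open scoped Classical in
/-- The Laplacian `Δ u (i) = ∑_{j ∼ i} (u i - u j)` of a finite simple graph. Its restriction to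
the boundary is the normal derivative. -/
noncomputable def graphLaplacian {W : Type*} [Fintype W] (H : SimpleGraph W) :
    (W → ℝ) →ₗ[ℝ] (W → ℝ) where
  toFun u i := ∑ j with H.Adj i j, (u i - u j)
  map_add' u v := by
    funext i
    simp only [Pi.add_apply, ← Finset.sum_add_distrib]
    exact Finset.sum_congr rfl fun j _ => by ring
  map_smul' c u := by
    funext i
    simp only [Pi.smul_apply, smul_eq_mul, RingHom.id_apply, Finset.mul_sum]
    exact Finset.sum_congr rfl fun j _ => by ring

/-- The space of solutions `u` of the Steklov problem with parameter `σ` on the finite graph with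
boundary `(H, B)`: `Δ u = 0` on the interior and `∂u/∂ν = σ u` on the boundary. -/
noncomputable def steklovEigenspace {W : Type*} [Fintype W] (H : SimpleGraph W) (B : Finset W)
    (σ : ℝ) : Submodule ℝ (W → ℝ) where
  carrier := {u | (∀ i, i ∉ B → graphLaplacian H u i = 0) ∧
    ∀ i ∈ B, graphLaplacian H u i = σ * u i}
  add_mem' {u v} hu hv :=
    ⟨fun i hi => by simp [hu.1 i hi, hv.1 i hi],
      fun i hi => by simp [hu.2 i hi, hv.2 i hi, mul_add]⟩
  zero_mem' := by simp
  smul_mem' c u hu :=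
    ⟨fun i hi => by simp [hu.1 i hi],
      fun i hi => by simp only [map_smul, Pi.smul_apply, smul_eq_mul, hu.2 i hi]; ring⟩

/-- The number of Steklov eigenvalues of `(H, B)` that are at most `σ`, counted with
multiplicity. -/
noncomputable def steklovCount {W : Type*} [Fintype W] (H : SimpleGraph W) (B : Finset W)
    (σ : ℝ) : ℕ :=
  Module.finrank ℝ ↥(⨆ τ : ℝ, ⨆ _ : τ ≤ σ, steklovEigenspace H B τ)

/-- `σ_k(H, B)`, the `k`-th Steklov eigenvalue, in the enumeration
`σ_0 ≤ σ_1 ≤ … ≤ σ_{|B|-1}` of the Steklov eigenvalues with multiplicity: the least `σ` such that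
more than `k` eigenvalues, counted with multiplicity, are at most `σ`. For a connected graph and
`k < |B|` the infimum is a minimum and a Steklov eigenvalue:
`isLeast_steklovEigenvalue`. -/
noncomputable def steklovEigenvalue {W : Type*} [Fintype W] (H : SimpleGraph W) (B : Finset W)
    (k : ℕ) : ℝ :=
  sInf {σ : ℝ | k < steklovCount H B σ}

section WellDefined

lemma graphLaplacian_apply {W : Type*} [Fintype W] (H : SimpleGraph W) [DecidableRel H.Adj]
    (u : W → ℝ) (i : W) :
    graphLaplacian H u i = ∑ j, if H.Adj i j then u i - u j else 0 := by
  classical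
  rw [← Finset.sum_filter]
  simp only [graphLaplacian, LinearMap.coe_mk, AddHom.coe_mk]
  congr!

/-- Green's formula. -/
lemma sum_graphLaplacian_mul {W : Type*} [Fintype W] (H : SimpleGraph W) [DecidableRel H.Adj]
    (u v : W → ℝ) :
    ∑ i, graphLaplacian H u i * v i =
      (∑ i, ∑ j, if H.Adj i j then (u i - u j) * (v i - v j) else 0) / 2 := by
  have h1 : ∑ i, graphLaplacian H u i * v i =
      ∑ i, ∑ j, if H.Adj i j then (u i - u j) * v i else 0 := by
    refine Finset.sum_congr rfl fun i _ => ?_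
    rw [graphLaplacian_apply, Finset.sum_mul]
    exact Finset.sum_congr rfl fun j _ => by split_ifs <;> simp
  have h2 : ∑ i, graphLaplacian H u i * v i =
      ∑ i, ∑ j, if H.Adj i j then (u j - u i) * v j else 0 := by
    rw [h1, Finset.sum_comm]
    exact Finset.sum_congr rfl fun j _ => Finset.sum_congr rfl fun i _ => by
      simp only [H.adj_comm]
  rw [eq_div_iff two_ne_zero, mul_two]
  nth_rewrite 1 [h1]
  rw [h2, ← Finset.sum_add_distrib]
  refine Finset.sum_congr rfl fun i _ => ?_
  rw [← Finset.sum_add_distrib]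
  refine Finset.sum_congr rfl fun j _ => ?_
  split_ifs
  · ring
  · simp

/-- A function that is harmonic in the interior and vanishes on the nonempty boundary of a connected
graph is zero. -/
lemma eq_zero_of_harmonic {W : Type*} [Fintype W] {H : SimpleGraph W} {B : Finset W}
    (hH : H.Connected) (hB : B.Nonempty) {u : W → ℝ}
    (hu : ∀ i, i ∉ B → graphLaplacian H u i = 0) (h0 : ∀ i ∈ B, u i = 0) : u = 0 := by
  classical
  have hE : ∑ i, graphLaplacian H u i * u i = 0 := by
    refine Finset.sum_eq_zero fun i _ => ?_
    by_cases hi : i ∈ B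
    · simp [h0 i hi]
    · simp [hu i hi]
  rw [sum_graphLaplacian_mul, div_eq_zero_iff, or_iff_left two_ne_zero] at hE
  have hnn : ∀ i j, 0 ≤ if H.Adj i j then (u i - u j) * (u i - u j) else 0 := fun i j => by
    split_ifs
    · exact mul_self_nonneg _
    · exact le_rfl
  have hadj : ∀ i j, H.Adj i j → u i = u j := by
    intro i j hij
    have h1 := (Finset.sum_eq_zero_iff_of_nonneg
      (fun i _ => Finset.sum_nonneg fun j _ => hnn i j)).1 hE i (Finset.mem_univ i)
    have h2 := (Finset.sum_eq_zero_iff_of_nonneg (fun j _ => hnn i j)).1 h1 j (Finset.mem_univ j)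
    rw [if_pos hij] at h2
    exact sub_eq_zero.1 (mul_self_eq_zero.1 h2)
  obtain ⟨b, hb⟩ := hB
  funext i
  obtain ⟨p⟩ := hH.preconnected i b
  have : ∀ (x y : W), H.Walk x y → u x = u y := by
    intro x y p
    induction p with
    | nil => rfl
    | cons h _ ih => exact (hadj _ _ h).trans ih
  rw [this i b p, h0 b hb, Pi.zero_apply]

lemma exists_finset_steklov {W : Type*} [Fintype W] {H : SimpleGraph W} {B : Finset W}
    (hH : H.Connected) (hB : B.Nonempty) :
    ∃ F : Finset ℝ, (∀ τ, steklovEigenspace H B τ ≠ ⊥ → τ ∈ F) ∧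
      B.card ≤ Module.finrank ℝ ↥(⨆ τ : ℝ, steklovEigenspace H B τ) := by
  classical
  let R : (W → ℝ) →ₗ[ℝ] EuclideanSpace ℝ B :=
    (WithLp.linearEquiv 2 ℝ (B → ℝ)).symm.toLinearMap ∘ₗ LinearMap.funLeft ℝ ℝ (Subtype.val)
  have hR : ∀ u b, R u b = u b := fun u b => rfl
  let I : (W → ℝ) →ₗ[ℝ] ({i // i ∉ B} → ℝ) :=
    LinearMap.funLeft ℝ ℝ (Subtype.val) ∘ₗ graphLaplacian H
  have hI : ∀ u i, I u i = graphLaplacian H u i := fun u i => rfl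
  let K := LinearMap.ker I
  have hK : ∀ u, u ∈ K ↔ ∀ i, i ∉ B → graphLaplacian H u i = 0 := fun u => by
    rw [LinearMap.mem_ker, funext_iff]
    exact ⟨fun h i hi => h ⟨i, hi⟩, fun h i => h i i.2⟩
  let r : K →ₗ[ℝ] EuclideanSpace ℝ B := R.domRestrict K
  have hr : ∀ (u : K) b, r u b = u.1 b := fun u b => rfl
  have hinj : Function.Injective r := by
    rw [injective_iff_map_eq_zero]
    intro u hu
    refine Subtype.ext (eq_zero_of_harmonic hH hB ((hK _).1 u.2) fun i hi => ?_)
    rw [← hr u ⟨i, hi⟩, hu]; rfl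
  have hdim : Module.finrank ℝ K = Module.finrank ℝ (EuclideanSpace ℝ B) := by
    refine le_antisymm (LinearMap.finrank_le_finrank_of_injective hinj) ?_
    have h1 := LinearMap.finrank_range_add_finrank_ker I
    have h2 := Submodule.finrank_le (LinearMap.range I)
    have h3 : Fintype.card {i // i ∉ B} = Fintype.card W - B.card := by
      rw [Fintype.card_subtype_compl]; simp
    have h4 : B.card ≤ Fintype.card W := Finset.card_le_univ B
    simp only [Module.finrank_fintype_fun_eq_card, finrank_euclideanSpace, Fintype.card_coe]
      at h1 h2 ⊢
    change _ + Module.finrank ℝ K = _ at h1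
    omega
  let e : K ≃ₗ[ℝ] EuclideanSpace ℝ B := LinearEquiv.ofInjectiveOfFinrankEq r hinj hdim
  have he : ∀ u b, e u b = u.1 b := fun u b => rfl
  let T : EuclideanSpace ℝ B →ₗ[ℝ] EuclideanSpace ℝ B :=
    R ∘ₗ graphLaplacian H ∘ₗ K.subtype ∘ₗ e.symm.toLinearMap
  have hT : ∀ u b, T (e u) b = graphLaplacian H u.1 b := fun u b => by
    simp [T, hR]
  have hinner : ∀ u v : K, inner ℝ (T (e u)) (e v) = ∑ i, graphLaplacian H u.1 i * v.1 i := by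
    intro u v
    rw [PiLp.inner_apply]
    simp only [hT, he, RCLike.inner_apply, conj_trivial]
    rw [Finset.sum_coe_sort B (fun b => v.1 b * graphLaplacian H u.1 b)]
    rw [← Finset.sum_subset (Finset.subset_univ B)]
    · exact Finset.sum_congr rfl fun _ _ => mul_comm _ _
    · intro i _ hi
      rw [(hK _).1 u.2 i hi, zero_mul]
  have hsymm : T.IsSymmetric := by
    intro x y
    obtain ⟨u, rfl⟩ := e.surjective x
    obtain ⟨v, rfl⟩ := e.surjective y
    rw [hinner, real_inner_comm, hinner, sum_graphLaplacian_mul, sum_graphLaplacian_mul]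
    simp only [mul_comm]
  have heig : ∀ τ (u : K), e u ∈ Module.End.eigenspace T τ ↔ u.1 ∈ steklovEigenspace H B τ := by
    intro τ u
    rw [Module.End.mem_eigenspace_iff]
    constructor
    · intro h
      refine ⟨(hK _).1 u.2, fun i hi => ?_⟩
      have := congrArg (fun x : EuclideanSpace ℝ B => x ⟨i, hi⟩) h
      simpa [hT, he] using this
    · intro h
      ext b
      rw [hT, h.2 b b.2]
      simp [he]
  have hfin : {τ : ℝ | Module.End.HasEigenvalue T τ}.Finite :=
    Module.End.finite_hasEigenvalue T
  refine ⟨hfin.toFinset, fun τ hτ => ?_, ?_⟩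
  · rw [Set.Finite.mem_toFinset, Set.mem_ofPred_eq, Module.End.hasEigenvalue_iff]
    intro hbot
    refine hτ ((Submodule.eq_bot_iff _).2 fun u hu => ?_)
    have huK : u ∈ K := (hK u).2 hu.1
    have := (heig τ ⟨u, huK⟩).2 hu
    have h0 : e ⟨u, huK⟩ = 0 := by
      rw [← Submodule.mem_bot ℝ, ← hbot]; exact this
    exact congrArg Subtype.val (e.map_eq_zero_iff.1 h0)
  · have htop : (⨆ τ, Module.End.eigenspace T τ) = ⊤ := by
      have := hsymm.orthogonalComplement_iSup_eigenspaces_eq_bot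
      rwa [Submodule.orthogonal_eq_bot_iff] at this
    have hle : K ≤ ⨆ τ : ℝ, steklovEigenspace H B τ := by
      have h1 : (⨆ τ, Module.End.eigenspace T τ) ≤
          (⨆ τ : ℝ, steklovEigenspace H B τ).comap (K.subtype ∘ₗ e.symm.toLinearMap) := by
        refine iSup_le fun τ x hx => ?_
        obtain ⟨u, rfl⟩ := e.surjective x
        have := (heig τ u).1 hx
        simpa using Submodule.mem_iSup_of_mem τ this
      intro u hu
      have h2 := h1 (htop ▸ Submodule.mem_top : e ⟨u, hu⟩ ∈ _)
      simpa using h2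
    calc B.card = Module.finrank ℝ K := by rw [hdim]; simp
      _ ≤ _ := Submodule.finrank_mono hle

/-- On a finite connected graph with nonempty boundary `B`, for `k < |B|`, the infimum that defines
`σ_k` is a minimum. -/
theorem isLeast_steklovEigenvalue {W : Type*} [Fintype W] {H : SimpleGraph W} {B : Finset W}
    (hH : H.Connected) {k : ℕ} (hk : k < B.card) :
    IsLeast {σ : ℝ | k < steklovCount H B σ} (steklovEigenvalue H B k) ∧
      steklovEigenspace H B (steklovEigenvalue H B k) ≠ ⊥ := by
  classical
  have hB : B.Nonempty := Finset.card_pos.1 (by omega)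
  obtain ⟨F, hF, hcard⟩ := exists_finset_steklov hH hB
  set A := {σ : ℝ | k < steklovCount H B σ}
  have hmono : ∀ σ σ', (∀ τ ∈ F, τ ≤ σ → steklovEigenspace H B τ ≠ ⊥ → τ ≤ σ') →
      steklovCount H B σ ≤ steklovCount H B σ' := by
    intro σ σ' h
    refine Submodule.finrank_mono (iSup₂_le fun τ hτ => ?_)
    by_cases hb : steklovEigenspace H B τ = ⊥
    · rw [hb]; exact bot_le
    · exact le_iSup₂_of_le τ (h τ (hF τ hb) hτ hb) le_rfl
  have hdown : ∀ σ ∈ A, ∃ m ∈ F, m ∈ A ∧ m ≤ σ ∧ steklovEigenspace H B m ≠ ⊥ := by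
    intro σ hσ
    let F' := F.filter fun τ => τ ≤ σ ∧ steklovEigenspace H B τ ≠ ⊥
    have hne : F'.Nonempty := by
      by_contra hne
      rw [Finset.not_nonempty_iff_eq_empty, Finset.filter_eq_empty_iff] at hne
      have : (⨆ τ : ℝ, ⨆ _ : τ ≤ σ, steklovEigenspace H B τ) = ⊥ := by
        refine le_bot_iff.1 (iSup₂_le fun τ hτ => ?_)
        by_contra hb
        have hb' : steklovEigenspace H B τ ≠ ⊥ := fun h => hb h.le
        exact hne (hF τ hb') ⟨hτ, hb'⟩
      have hσ' : k < steklovCount H B σ := hσ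
      rw [steklovCount, this, finrank_bot] at hσ'
      omega
    have hm := F'.max'_mem hne
    obtain ⟨hmF, hmσ, hmb⟩ := Finset.mem_filter.1 hm
    refine ⟨F'.max' hne, hmF, lt_of_lt_of_le hσ (hmono _ _ fun τ hτ hτσ hb => ?_), hmσ, hmb⟩
    exact F'.le_max' τ (Finset.mem_filter.2 ⟨hτ, hτσ, hb⟩)
  have hAne : A.Nonempty := by
    obtain ⟨M, hM⟩ := F.bddAbove
    refine ⟨M, lt_of_lt_of_le hk (hcard.trans ?_)⟩
    refine Submodule.finrank_mono (iSup_le fun τ => ?_)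
    by_cases hb : steklovEigenspace H B τ = ⊥
    · rw [hb]; exact bot_le
    · exact le_iSup₂_of_le τ (hM (hF τ hb)) le_rfl
  let FA := F.filter fun m => m ∈ A ∧ steklovEigenspace H B m ≠ ⊥
  have hFA : FA.Nonempty := by
    obtain ⟨σ, hσ⟩ := hAne
    obtain ⟨m, hm, hmA, -, hmb⟩ := hdown σ hσ
    exact ⟨m, Finset.mem_filter.2 ⟨hm, hmA, hmb⟩⟩
  obtain ⟨-, hm1, hm2⟩ := Finset.mem_filter.1 (FA.min'_mem hFA)
  have hleast : IsLeast A (FA.min' hFA) := by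
    refine ⟨hm1, fun σ hσ => ?_⟩
    obtain ⟨m, hm, hmA, hmσ, hmb⟩ := hdown σ hσ
    exact (FA.min'_le m (Finset.mem_filter.2 ⟨hm, hmA, hmb⟩)).trans hmσ
  have heq : steklovEigenvalue H B k = FA.min' hFA := hleast.csInf_eq
  rw [heq]
  exact ⟨hleast, hm2⟩

end WellDefined

section Subgraphs

variable {V : Type*}

open scoped Classical in
/-- The vertex boundary `B` of a finite set `Ω` of vertices: the vertices outside `Ω` that are
adjacent to a vertex of `Ω`. -/
noncomputable def vertexBoundary (Γ : SimpleGraph V) [Γ.LocallyFinite] (Ω : Finset V) :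
    Finset V :=
  (Ω.biUnion fun i => Γ.neighborFinset i) \ Ω

lemma mem_vertexBoundary {Γ : SimpleGraph V} [Γ.LocallyFinite] {Ω : Finset V} {j : V} :
    j ∈ vertexBoundary Γ Ω ↔ j ∉ Ω ∧ ∃ i ∈ Ω, Γ.Adj i j := by
  simp [vertexBoundary, and_comm]

open scoped Classical in
/-- `Ω̄ = Ω ∪ B`. -/
noncomputable def vertexClosure (Γ : SimpleGraph V) [Γ.LocallyFinite] (Ω : Finset V) :
    Finset V :=
  Ω ∪ vertexBoundary Γ Ω

/-- The subgraph `(Ω, B)` of `Γ`: its vertices are those of `Ω̄` and its edges are the edges of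
`Γ` between a vertex of `Ω` and a vertex of `Ω̄`. -/
def boundarySubgraph (Γ : SimpleGraph V) [Γ.LocallyFinite] (Ω : Finset V) :
    SimpleGraph ↥(vertexClosure Γ Ω) where
  Adj i j := Γ.Adj i j ∧ (i.1 ∈ Ω ∨ j.1 ∈ Ω)
  symm := ⟨fun _ _ h => ⟨h.1.symm, h.2.symm⟩⟩
  loopless := ⟨fun _ h => h.1.ne rfl⟩

open scoped Classical in
/-- `σ_k(Ω, B)`. -/
noncomputable def subgraphSteklovEigenvalue (Γ : SimpleGraph V) [Γ.LocallyFinite]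
    (Ω : Finset V) (k : ℕ) : ℝ :=
  steklovEigenvalue (boundarySubgraph Γ Ω)
    ((vertexBoundary Γ Ω).subtype (· ∈ vertexClosure Γ Ω)) k

end Subgraphs

noncomputable instance cayleyGraphLocallyFinite {G : Type*} [Group G] (S : Finset G) :
    (SimpleGraph.mulCayley (S : Set G)).LocallyFinite := fun g =>
  Set.Finite.fintype <| by
    classical
    refine ((S ∪ S.image (·⁻¹)).image (g * ·)).finite_toSet.subset fun h hh => ?_
    rw [SimpleGraph.mem_neighborSet, SimpleGraph.mulCayley_adj] at hh
    simp only [Finset.coe_image, Set.mem_image, Finset.mem_coe, Finset.mem_union,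
      Finset.mem_image]
    refine ⟨g⁻¹ * h, ?_, by group⟩
    rcases hh.2 with h1 | h1
    · exact Or.inl h1
    · exact Or.inr ⟨_, h1, by group⟩

/-- The Cayley graph `Cay(G, S)` has polynomial growth of order `d`: the number of elements of
the ball of radius `n` centered at the identity lies between `C⁻¹ n ^ d` and `C n ^ d`. -/
def HasPolynomialGrowth {G : Type*} [Group G] (S : Finset G) (d : ℕ) : Prop :=
  ∃ C : ℝ, 1 ≤ C ∧ ∀ n : ℕ, 1 ≤ n →
    C⁻¹ * (n : ℝ) ^ d ≤
        ({g : G | (SimpleGraph.mulCayley (S : Set G)).edist 1 g ≤ n}.ncard : ℝ) ∧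
      ({g : G | (SimpleGraph.mulCayley (S : Set G)).edist 1 g ≤ n}.ncard : ℝ) ≤ C * (n : ℝ) ^ d

/-!
The bound follows from the min-max principle: `σ_k ≤ 2 E / m` as soon as there are `k + 1` functions
with disjoint supports, each of Dirichlet energy at most `E` and of squared norm at least `m` on the
boundary `B` (`steklovEigenvalue_le_of_disjoint`, which rests on
`steklovEigenvalue_le_of_energy_le`).

The energy is controlled through the `d`-energy `∑ |f x - f y| ^ d`. In a graph of growth `n ^ d` the
natural cut-off function of a ball has `d`-energy bounded independently of the radius
(`pairEnergy_cutoff_le`), and by Hölder's inequality a `d`-energy `D` on the subgraph gives energy at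
most a constant times `|Ω̄| ^ (1 - 2 / d) * D ^ (2 / d)` (`sum_sq_le_pairEnergy`).

The test functions come from a greedy construction (`exists_disjoint_testFunctions`). With `m` of
order `|B| / k`, take a ball of minimal radius carrying `m` of the remaining points of `B`, use its
cut-off function, and remove the points of `B` in the concentric ball of three times the radius. By
minimality and doubling this removes at most a constant times `m` points (`card_inter_ball_le`), so
`k + 1` steps are possible. Each function is also cut off away from the previous balls; it is a
minimum of at most `k + 1` cut-offs and its `d`-energy is at most a constant times `k`. For `|B|` at
most a constant times `k` the construction is replaced by point masses
(`subgraphSteklovEigenvalue_le_degree`).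

Altogether `σ_k` is at most a constant times `|Ω̄| ^ (1 - 2 / d) * k ^ (1 + 2 / d) / |B|`, and the
isoperimetric inequality `|Ω| ^ (d - 1) ≤ const * |B| ^ d` (`card_pow_le_card_vertexBoundary_pow`)
turns this into the claim.
-/

/-! ### The variational characterization of Steklov eigenvalues -/

lemma sum_graphLaplacian_mul_comm {W : Type*} [Fintype W] (H : SimpleGraph W) (u v : W → ℝ) :
    ∑ i, graphLaplacian H u i * v i = ∑ i, graphLaplacian H v i * u i := by
  classical
  rw [sum_graphLaplacian_mul, sum_graphLaplacian_mul]
  simp only [mul_comm]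

lemma sum_graphLaplacian_mul_self_nonneg {W : Type*} [Fintype W] (H : SimpleGraph W)
    (u : W → ℝ) : 0 ≤ ∑ i, graphLaplacian H u i * u i := by
  classical
  rw [sum_graphLaplacian_mul]
  refine div_nonneg (Finset.sum_nonneg fun i _ => Finset.sum_nonneg fun j _ => ?_) two_pos.le
  split_ifs
  · exact mul_self_nonneg _
  · exact le_rfl

lemma sum_graphLaplacian_mul_of_mem_steklovEigenspace {W : Type*} [Fintype W]
    {H : SimpleGraph W} {B : Finset W} {σ : ℝ} {u : W → ℝ} (hu : u ∈ steklovEigenspace H B σ)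
    (v : W → ℝ) : ∑ i, graphLaplacian H u i * v i = σ * ∑ b ∈ B, u b * v b := by
  rw [← Finset.sum_subset (Finset.subset_univ B), Finset.mul_sum]
  · exact Finset.sum_congr rfl fun b hb => by rw [hu.2 b hb, mul_assoc]
  · intro i _ hi
    rw [hu.1 i hi, zero_mul]

lemma sum_mul_eq_zero_of_mem_steklovEigenspace {W : Type*} [Fintype W]
    {H : SimpleGraph W} {B : Finset W} {σ τ : ℝ} (hστ : σ ≠ τ) {u v : W → ℝ}
    (hu : u ∈ steklovEigenspace H B σ) (hv : v ∈ steklovEigenspace H B τ) :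
    ∑ b ∈ B, u b * v b = 0 := by
  have h := sum_graphLaplacian_mul_comm H u v
  rw [sum_graphLaplacian_mul_of_mem_steklovEigenspace hu,
    sum_graphLaplacian_mul_of_mem_steklovEigenspace hv] at h
  simp only [mul_comm (v _)] at h
  exact (mul_eq_mul_right_iff.1 h).resolve_left hστ

lemma harmonic_of_mem_iSup_steklovEigenspace {W : Type*} [Fintype W] {H : SimpleGraph W}
    {B : Finset W} {Λ : ℝ} {v : W → ℝ}
    (hv : v ∈ ⨆ τ : ℝ, ⨆ _ : Λ < τ, steklovEigenspace H B τ) {i : W} (hi : i ∉ B) :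
    graphLaplacian H v i = 0 := by
  have hle : (⨆ τ : ℝ, ⨆ _ : Λ < τ, steklovEigenspace H B τ) ≤
      LinearMap.ker (LinearMap.proj i ∘ₗ graphLaplacian H) :=
    iSup₂_le fun τ _ u hu => hu.1 i hi
  exact hle hv

/-- On the span of the eigenspaces with eigenvalue above `Λ`, the Rayleigh quotient is above
`Λ`. -/
lemma lt_energy_of_mem_iSup_steklovEigenspace {W : Type*} [Fintype W] {H : SimpleGraph W}
    {B : Finset W} (hH : H.Connected) (hB : B.Nonempty) {Λ : ℝ} {v : W → ℝ}
    (hv : v ∈ ⨆ τ : ℝ, ⨆ _ : Λ < τ, steklovEigenspace H B τ) (hv0 : v ≠ 0) :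
    Λ * ∑ b ∈ B, v b * v b < ∑ i, graphLaplacian H v i * v i := by
  classical
  rw [iSup_subtype', Submodule.mem_iSup_iff_exists_finsupp] at hv
  obtain ⟨f, hf, rfl⟩ := hv
  simp only [Finsupp.sum] at hv0 ⊢
  set s := f.support
  have horth : ∀ σ : {τ // Λ < τ},
      ∑ b ∈ B, f σ b * (∑ τ ∈ s, f τ) b = ∑ b ∈ B, f σ b * f σ b := by
    intro σ
    simp only [Finset.sum_apply, Finset.mul_sum]
    rw [Finset.sum_comm]
    refine Finset.sum_eq_single σ (fun τ _ hτ => ?_) fun hσ => ?_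
    · exact sum_mul_eq_zero_of_mem_steklovEigenspace
        (fun h => hτ (Subtype.ext h.symm)) (hf σ) (hf τ)
    · simp [Finsupp.notMem_support_iff.1 hσ]
  have h1 : ∑ b ∈ B, (∑ τ ∈ s, f τ) b * (∑ τ ∈ s, f τ) b =
      ∑ σ ∈ s, ∑ b ∈ B, f σ b * f σ b := by
    rw [← Finset.sum_congr rfl fun σ _ => horth σ, Finset.sum_comm]
    refine Finset.sum_congr rfl fun b _ => ?_
    rw [← Finset.sum_mul, Finset.sum_apply]
  have h2 : ∑ i, graphLaplacian H (∑ τ ∈ s, f τ) i * (∑ τ ∈ s, f τ) i =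
      ∑ σ ∈ s, σ.1 * ∑ b ∈ B, f σ b * f σ b := by
    rw [← Finset.sum_congr rfl fun σ _ => congrArg (σ.1 * ·) (horth σ)]
    simp only [← sum_graphLaplacian_mul_of_mem_steklovEigenspace (hf _)]
    rw [Finset.sum_comm]
    refine Finset.sum_congr rfl fun b _ => ?_
    rw [← Finset.sum_mul, map_sum, Finset.sum_apply]
  rw [h1, h2, Finset.mul_sum]
  have hnn : ∀ σ, 0 ≤ ∑ b ∈ B, f σ b * f σ b :=
    fun σ => Finset.sum_nonneg fun b _ => mul_self_nonneg _
  refine Finset.sum_lt_sum (fun σ _ => mul_le_mul_of_nonneg_right σ.2.le (hnn σ)) ?_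
  obtain ⟨σ, hσ, hσ0⟩ := Finset.exists_ne_zero_of_sum_ne_zero hv0
  refine ⟨σ, hσ, mul_lt_mul_of_pos_right σ.2 ((hnn σ).lt_of_ne' fun h => hσ0 ?_)⟩
  refine eq_zero_of_harmonic hH hB (fun i hi => (hf σ).1 i hi) fun b hb => ?_
  exact mul_self_eq_zero.1
    ((Finset.sum_eq_zero_iff_of_nonneg fun b _ => mul_self_nonneg _).1 h b hb)

/-- The min-max bound: if a `(k + 1)`-dimensional space of functions, which restricts injectively to
the boundary, has Rayleigh quotients at most `Λ`, then `σ_k ≤ Λ`. -/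
theorem steklovEigenvalue_le_of_energy_le {W : Type*} [Fintype W] {H : SimpleGraph W}
    {B : Finset W} (hH : H.Connected) {k : ℕ} (hk : k < B.card) {Λ : ℝ}
    (A : (Fin (k + 1) → ℝ) →ₗ[ℝ] (W → ℝ)) (hA : ∀ a, (∀ b ∈ B, A a b = 0) → a = 0)
    (hE : ∀ a, ∑ i, graphLaplacian H (A a) i * A a i ≤ Λ * ∑ b ∈ B, A a b * A a b) :
    steklovEigenvalue H B k ≤ Λ := by
  classical
  have hB : B.Nonempty := Finset.card_pos.1 (by omega)
  refine csInf_le ⟨_, (isLeast_steklovEigenvalue hH hk).1.2⟩ ?_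
  by_contra hcount
  replace hcount : steklovCount H B Λ ≤ k := not_lt.1 hcount
  set Vhi := ⨆ τ : ℝ, ⨆ _ : Λ < τ, steklovEigenspace H B τ
  have hhi : B.card ≤ k + Module.finrank ℝ Vhi := by
    obtain ⟨-, -, hcard⟩ := exists_finset_steklov hH hB
    refine hcard.trans (le_trans ?_ (Nat.add_le_add_right hcount _))
    refine le_trans (Submodule.finrank_mono (iSup_le fun τ => ?_))
      (Submodule.finrank_add_le_finrank_add_finrank _ Vhi)
    rcases le_or_gt τ Λ with h | h
    · exact le_sup_of_le_left (le_iSup₂_of_le τ h le_rfl)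
    · exact le_sup_of_le_right (le_iSup₂_of_le τ h le_rfl)
  let R : (W → ℝ) →ₗ[ℝ] (B → ℝ) := LinearMap.funLeft ℝ ℝ Subtype.val
  let T : ((Fin (k + 1) → ℝ) × Vhi) →ₗ[ℝ] (B → ℝ) :=
    LinearMap.coprod (R ∘ₗ A) (-(R ∘ₗ Vhi.subtype))
  -- The dimensions force a test function to agree on the boundary with a function in `Vhi`.
  obtain ⟨⟨a, v⟩, hker, hne⟩ : ∃ p, p ∈ LinearMap.ker T ∧ p ≠ 0 := by
    refine (Submodule.ne_bot_iff _).1 (LinearMap.ker_ne_bot_of_finrank_lt ?_)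
    rw [Module.finrank_prod]
    simp only [Module.finrank_fintype_fun_eq_card, Fintype.card_coe, Fintype.card_fin]
    omega
  have hb : ∀ b ∈ B, A a b = v.1 b := by
    intro b hb
    have := congrFun (LinearMap.mem_ker.1 hker) ⟨b, hb⟩
    simpa [T, R, LinearMap.funLeft_apply, ← sub_eq_add_neg, sub_eq_zero] using this
  have hv0 : v.1 ≠ 0 := by
    intro h0
    refine hne (Prod.ext (hA a fun b hbB => ?_) (Subtype.ext h0))
    rw [hb b hbB, h0, Pi.zero_apply]
  have hlt := lt_energy_of_mem_iSup_steklovEigenspace hH hB v.2 hv0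
  -- `v` minimizes the energy among the functions with its boundary values.
  have hle : ∑ i, graphLaplacian H v.1 i * v.1 i ≤ ∑ i, graphLaplacian H (A a) i * A a i := by
    set w := A a - v.1 with hw
    have huw : A a = v.1 + w := by rw [hw]; abel
    have h0 : ∑ i, graphLaplacian H v.1 i * w i = 0 := by
      refine Finset.sum_eq_zero fun i _ => ?_
      by_cases hi : i ∈ B
      · simp [hw, hb i hi]
      · rw [harmonic_of_mem_iSup_steklovEigenspace v.2 hi, zero_mul]
    have h0' := h0
    rw [sum_graphLaplacian_mul_comm] at h0'
    have h1 := sum_graphLaplacian_mul_self_nonneg H w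
    have : ∑ i, graphLaplacian H (A a) i * A a i =
        ∑ i, graphLaplacian H v.1 i * v.1 i + ∑ i, graphLaplacian H v.1 i * w i +
          (∑ i, graphLaplacian H w i * v.1 i + ∑ i, graphLaplacian H w i * w i) := by
      rw [huw, map_add, ← Finset.sum_add_distrib, ← Finset.sum_add_distrib,
        ← Finset.sum_add_distrib]
      exact Finset.sum_congr rfl fun i _ => by simp only [Pi.add_apply]; ring
    linarith
  have hmass : ∑ b ∈ B, A a b * A a b = ∑ b ∈ B, v.1 b * v.1 b :=
    Finset.sum_congr rfl fun b hbB => by rw [hb b hbB]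
  have hEa := hE a
  rw [hmass] at hEa
  linarith

/-- For functions with disjoint supports, an edge meets at most two of the supports; this costs the
factor `2`. -/
lemma sq_sum_sub_sum_le_of_disjoint {ι : Type*} [Fintype ι] {c e : ι → ℝ}
    (h : ∀ i j, i ≠ j → c i = 0 ∨ c j = 0) (h' : ∀ i j, i ≠ j → e i = 0 ∨ e j = 0) :
    (∑ i, c i - ∑ i, e i) * (∑ i, c i - ∑ i, e i) ≤ 2 * ∑ i, (c i - e i) * (c i - e i) := by
  classical
  rcases isEmpty_or_nonempty ι with hι | hι
  · simp
  have key : ∀ u : ι → ℝ, (∀ i j, i ≠ j → u i = 0 ∨ u j = 0) → ∃ p, ∀ i, i ≠ p → u i = 0 := by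
    intro u hu
    by_cases h0 : ∃ p, u p ≠ 0
    · obtain ⟨p, hp⟩ := h0
      exact ⟨p, fun i hi => (hu i p hi).resolve_right hp⟩
    · push Not at h0
      exact ⟨Classical.arbitrary ι, fun i _ => h0 i⟩
  obtain ⟨p, hp⟩ := key c h
  obtain ⟨q, hq⟩ := key e h'
  rw [Fintype.sum_eq_single p hp, Fintype.sum_eq_single q hq]
  have hnn : ∀ i, 0 ≤ (c i - e i) * (c i - e i) := fun i => mul_self_nonneg _
  by_cases hpq : p = q
  · subst hpq
    have := Finset.single_le_sum (fun i _ => hnn i) (Finset.mem_univ p)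
    linarith [hnn p]
  · have h2 := Finset.sum_le_sum_of_subset_of_nonneg (Finset.subset_univ {p, q})
      (fun i _ _ => hnn i)
    rw [Finset.sum_pair hpq, hp q (Ne.symm hpq), hq p hpq] at h2
    nlinarith [sq_nonneg (c p + e q)]

/-- The min-max bound for the span of `k + 1` functions with disjoint supports. -/
theorem steklovEigenvalue_le_of_disjoint {W : Type*} [Fintype W] {H : SimpleGraph W}
    {B : Finset W} (hH : H.Connected) {k : ℕ} (hk : k < B.card) {E m : ℝ} (hm : 0 < m)
    (f : Fin (k + 1) → W → ℝ) (hdisj : ∀ i j, i ≠ j → ∀ x, f i x = 0 ∨ f j x = 0)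
    (hE : ∀ i, ∑ x, graphLaplacian H (f i) x * f i x ≤ E)
    (hmass : ∀ i, m ≤ ∑ b ∈ B, f i b * f i b) :
    steklovEigenvalue H B k ≤ 2 * E / m := by
  classical
  let A : (Fin (k + 1) → ℝ) →ₗ[ℝ] (W → ℝ) := Fintype.linearCombination ℝ f
  have hAx : ∀ a x, A a x = ∑ i, a i * f i x := fun a x => by
    simp [A, Fintype.linearCombination_apply]
  have hdisj' : ∀ (a : Fin (k + 1) → ℝ) x i j, i ≠ j → a i * f i x = 0 ∨ a j * f j x = 0 :=
    fun a x i j hij => (hdisj i j hij x).imp (fun h => by rw [h, mul_zero])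
      fun h => by rw [h, mul_zero]
  have hsq : ∀ a, ∑ b ∈ B, A a b * A a b = ∑ i, a i ^ 2 * ∑ b ∈ B, f i b * f i b := by
    intro a
    simp only [hAx, Finset.mul_sum]
    rw [Finset.sum_comm]
    refine Finset.sum_congr rfl fun i _ => Finset.sum_congr rfl fun b _ => ?_
    rw [Finset.sum_mul, Finset.sum_eq_single i]
    · ring
    · intro j _ hj
      rcases hdisj j i hj b with h | h <;> simp [h]
    · simp
  have hlow : ∀ a, m * ∑ i, a i ^ 2 ≤ ∑ b ∈ B, A a b * A a b := by
    intro a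
    rw [hsq, Finset.mul_sum]
    refine Finset.sum_le_sum fun i _ => ?_
    rw [mul_comm]
    exact mul_le_mul_of_nonneg_left (hmass i) (sq_nonneg _)
  refine steklovEigenvalue_le_of_energy_le hH hk A (fun a ha => ?_) fun a => ?_
  · have h0 : ∑ b ∈ B, A a b * A a b = 0 :=
      Finset.sum_eq_zero fun b hb => by rw [ha b hb, mul_zero]
    have h1 : ∑ i, a i ^ 2 = 0 := by
      refine le_antisymm ?_ (Finset.sum_nonneg fun i _ => sq_nonneg _)
      have := hlow a
      rw [h0] at this
      exact nonpos_of_mul_nonpos_right this hm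
    funext i
    exact pow_eq_zero_iff two_ne_zero |>.1
      ((Finset.sum_eq_zero_iff_of_nonneg fun i _ => sq_nonneg _).1 h1 i (Finset.mem_univ i))
  · have hE0 : 0 ≤ E := (sum_graphLaplacian_mul_self_nonneg H (f 0)).trans (hE 0)
    have hup : ∑ x, graphLaplacian H (A a) x * A a x ≤
        ∑ i, 2 * a i ^ 2 * ∑ x, graphLaplacian H (f i) x * f i x := by
      simp only [sum_graphLaplacian_mul, mul_div_assoc', ← Finset.sum_div]
      refine div_le_div_of_nonneg_right ?_ two_pos.le
      simp only [Finset.mul_sum]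
      refine le_of_le_of_eq (Finset.sum_le_sum fun x _ => ?_) Finset.sum_comm
      refine le_of_le_of_eq (Finset.sum_le_sum fun y _ => ?_) Finset.sum_comm
      split_ifs
      · rw [hAx, hAx]
        refine (sq_sum_sub_sum_le_of_disjoint (hdisj' a x) (hdisj' a y)).trans_eq ?_
        rw [Finset.mul_sum]
        exact Finset.sum_congr rfl fun i _ => by ring
      · simp
    refine hup.trans ?_
    calc ∑ i, 2 * a i ^ 2 * ∑ x, graphLaplacian H (f i) x * f i x
        ≤ ∑ i, 2 * a i ^ 2 * E := Finset.sum_le_sum fun i _ =>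
          mul_le_mul_of_nonneg_left (hE i) (mul_nonneg two_pos.le (sq_nonneg _))
      _ = 2 * E / m * (m * ∑ i, a i ^ 2) := by
          rw [← Finset.sum_mul, ← Finset.mul_sum]
          field_simp
      _ ≤ _ := mul_le_mul_of_nonneg_left (hlow a) (by positivity)

/-! ### Cut-off functions and their `d`-energy -/

/-- The `d`-energy `∑ |g x - g y| ^ d` of a function `g` over a finite set `P` of pairs of
vertices. -/
def pairEnergy {V : Type*} (P : Finset (V × V)) (d : ℕ) (g : V → ℝ) : ℝ :=
  ∑ p ∈ P, |g p.1 - g p.2| ^ d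

lemma pairEnergy_min_le {V : Type*} (P : Finset (V × V)) (d : ℕ) (g h : V → ℝ) :
    pairEnergy P d (fun x => min (g x) (h x)) ≤ pairEnergy P d g + pairEnergy P d h := by
  unfold pairEnergy
  rw [← Finset.sum_add_distrib]
  refine Finset.sum_le_sum fun p _ => ?_
  have h1 := abs_min_sub_min_le_max (g p.1) (h p.1) (g p.2) (h p.2)
  refine (pow_le_pow_left₀ (abs_nonneg _) h1 d).trans ?_
  rcases max_choice |g p.1 - g p.2| |h p.1 - h p.2| with h2 | h2 <;> rw [h2]
  · exact le_add_of_nonneg_right (by positivity)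
  · exact le_add_of_nonneg_left (by positivity)

lemma pairEnergy_one_sub {V : Type*} (P : Finset (V × V)) (d : ℕ) (g : V → ℝ) :
    pairEnergy P d (fun x => 1 - g x) = pairEnergy P d g := by
  unfold pairEnergy
  refine Finset.sum_congr rfl fun p _ => ?_
  rw [sub_sub_sub_cancel_left, abs_sub_comm]

/-- Hölder's inequality between the quadratic energy and the `d`-energy. -/
lemma sum_sq_le_pairEnergy {V : Type*} (P : Finset (V × V)) {d : ℕ} (hd : 2 ≤ d) (g : V → ℝ) :
    ∑ p ∈ P, (g p.1 - g p.2) * (g p.1 - g p.2) ≤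
      (P.card : ℝ) ^ (1 - 2 / (d : ℝ)) * pairEnergy P d g ^ (2 / (d : ℝ)) := by
  have hd0 : (0 : ℝ) < d := by positivity
  have hd2 : (2 : ℝ) ≤ d := by exact_mod_cast hd
  have h := Real.rpow_sum_le_const_mul_sum_rpow_of_nonneg P (p := (d : ℝ) / 2)
    (f := fun p => (g p.1 - g p.2) * (g p.1 - g p.2)) (by linarith) fun p _ => mul_self_nonneg _
  have h1 : ∑ p ∈ P, ((g p.1 - g p.2) * (g p.1 - g p.2)) ^ ((d : ℝ) / 2) = pairEnergy P d g := by
    refine Finset.sum_congr rfl fun p _ => ?_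
    rw [← abs_mul_abs_self, ← sq, ← Real.rpow_natCast, ← Real.rpow_mul (abs_nonneg _),
      ← Real.rpow_natCast]
    congr 1
    push_cast
    ring
  rw [h1] at h
  have hs : 0 ≤ ∑ p ∈ P, (g p.1 - g p.2) * (g p.1 - g p.2) :=
    Finset.sum_nonneg fun p _ => mul_self_nonneg _
  have hE : 0 ≤ pairEnergy P d g := Finset.sum_nonneg fun p _ => by positivity
  have h2 := Real.rpow_le_rpow (Real.rpow_nonneg hs _) h (z := 2 / (d : ℝ)) (by positivity)
  rw [← Real.rpow_mul hs, Real.mul_rpow (by positivity) hE, ← Real.rpow_mul (by positivity)] at h2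
  have e1 : (d : ℝ) / 2 * (2 / d) = 1 := by field_simp
  have e2 : ((d : ℝ) / 2 - 1) * (2 / d) = 1 - 2 / d := by rw [sub_mul, e1, one_mul]
  rwa [e1, Real.rpow_one, e2] at h2

/-- The cut-off function `min 1 (c - dist(x, y) / r)⁺` around `x`: it is `1` up to distance
`(c - 1) r` and `0` from distance `c r` on. -/
noncomputable def cutoff {V : Type*} (Γ : SimpleGraph V) (x : V) (r : ℕ) (c : ℝ) (y : V) : ℝ :=
  max 0 (min 1 (c - Γ.dist x y / r))

lemma cutoff_nonneg {V : Type*} (Γ : SimpleGraph V) (x : V) (r : ℕ) (c : ℝ) (y : V) :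
    0 ≤ cutoff Γ x r c y := le_max_left _ _

lemma cutoff_le_one {V : Type*} (Γ : SimpleGraph V) (x : V) (r : ℕ) (c : ℝ) (y : V) :
    cutoff Γ x r c y ≤ 1 := max_le zero_le_one (min_le_left _ _)

lemma cutoff_eq_zero {V : Type*} {Γ : SimpleGraph V} {x y : V} {r : ℕ} {c : ℝ} (hr : 1 ≤ r)
    (h : c * r ≤ Γ.dist x y) : cutoff Γ x r c y = 0 := by
  have hr0 : (0 : ℝ) < r := by exact_mod_cast hr
  have h1 : c ≤ Γ.dist x y / r := by rwa [le_div_iff₀ hr0]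
  exact max_eq_left ((min_le_right _ _).trans (by linarith))

lemma cutoff_eq_one {V : Type*} {Γ : SimpleGraph V} {x y : V} {r : ℕ} {c : ℝ} (hr : 1 ≤ r)
    (h : (Γ.dist x y : ℝ) ≤ (c - 1) * r) : cutoff Γ x r c y = 1 := by
  have hr0 : (0 : ℝ) < r := by exact_mod_cast hr
  have h1 : Γ.dist x y / r ≤ c - 1 := by rwa [div_le_iff₀ hr0]
  rw [cutoff, min_eq_left (by linarith), max_eq_right zero_le_one]

/-- The cut-off function at scale `r` has slope `1 / r` on a set of about `r ^ d` pairs, so its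
`d`-energy is bounded independently of `r`. -/
lemma pairEnergy_cutoff_le {V : Type*} {Γ : SimpleGraph V} (hΓ : Γ.Connected) {d : ℕ}
    (hd : d ≠ 0) {C : ℝ}
    (hfin : ∀ x (n : ℕ), {y | Γ.dist x y ≤ n}.Finite)
    (hvol : ∀ x (n : ℕ), 1 ≤ n → ({y | Γ.dist x y ≤ n}.ncard : ℝ) ≤ C * (n : ℝ) ^ d)
    {P : Finset (V × V)} (hP : ∀ p ∈ P, Γ.Adj p.1 p.2) {Δ : ℕ}
    (hΔ : ∀ x, {p ∈ (P : Set (V × V)) | p.1 = x}.ncard ≤ Δ) (x : V) {r : ℕ} (hr : 1 ≤ r)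
    {c : ℝ} (hc : c ≤ 3) : pairEnergy P d (cutoff Γ x r c) ≤ Δ * (C * 3 ^ d) := by
  classical
  have hr0 : (0 : ℝ) < r := by exact_mod_cast hr
  -- Distances are integers, so an edge whose first end is outside this ball has both ends at
  -- distance at least `3 r`, where the cut-off function vanishes.
  set Q := P.filter fun p => Γ.dist x p.1 ≤ 3 * r
  have hQ : (Q.card : ℝ) ≤ Δ * (C * ((3 * r : ℕ) : ℝ) ^ d) := by
    have h1 : Q.card ≤ Δ * (hfin x (3 * r)).toFinset.card := by
      refine Finset.card_le_mul_card_image_of_maps_to (f := Prod.fst)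
        (fun p hp => ?_) Δ fun y _ => ?_
      · simpa using (Finset.mem_filter.1 hp).2
      · refine le_trans ?_ (hΔ y)
        rw [← Set.ncard_coe_finset]
        refine Set.ncard_le_ncard (fun p hp => ?_) (P.finite_toSet.subset (Set.sep_subset _ _))
        simp only [Finset.coe_filter, Set.mem_ofPred_eq, Q, Finset.mem_filter] at hp
        exact ⟨hp.1.1, hp.2⟩
    rw [← Set.ncard_eq_toFinset_card _ (hfin x (3 * r))] at h1
    calc (Q.card : ℝ) ≤ Δ * ({y | Γ.dist x y ≤ 3 * r}.ncard : ℝ) := by exact_mod_cast h1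
      _ ≤ _ := mul_le_mul_of_nonneg_left (hvol x _ (by omega)) (by positivity)
  have hterm : ∀ p ∈ P, |cutoff Γ x r c p.1 - cutoff Γ x r c p.2| ^ d ≤
      if Γ.dist x p.1 ≤ 3 * r then (1 / (r : ℝ)) ^ d else 0 := by
    intro p hp
    have hdist1 : Γ.dist x p.1 ≤ Γ.dist x p.2 + 1 := by
      have := hΓ.dist_triangle (u := x) (v := p.2) (w := p.1)
      rwa [SimpleGraph.dist_eq_one_iff_adj.2 (hP p hp).symm] at this
    have hdist2 : Γ.dist x p.2 ≤ Γ.dist x p.1 + 1 := by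
      have := hΓ.dist_triangle (u := x) (v := p.1) (w := p.2)
      rwa [SimpleGraph.dist_eq_one_iff_adj.2 (hP p hp)] at this
    split_ifs with h
    · refine pow_le_pow_left₀ (abs_nonneg _) ?_ d
      have h1 : (Γ.dist x p.1 : ℝ) ≤ Γ.dist x p.2 + 1 := by exact_mod_cast hdist1
      have h2 : (Γ.dist x p.2 : ℝ) ≤ Γ.dist x p.1 + 1 := by exact_mod_cast hdist2
      calc |cutoff Γ x r c p.1 - cutoff Γ x r c p.2|
          ≤ |(c - Γ.dist x p.1 / r) - (c - Γ.dist x p.2 / r)| := by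
            unfold cutoff
            refine (abs_max_sub_max_le_max _ _ _ _).trans (max_le (by simp) ?_)
            exact (abs_min_sub_min_le_max _ _ _ _).trans (max_le (by simp) le_rfl)
        _ = |((Γ.dist x p.2 : ℝ) - Γ.dist x p.1) / r| := by congr 1; ring
        _ ≤ 1 / r := by
            rw [abs_div, abs_of_pos hr0]
            exact div_le_div_of_nonneg_right (abs_le.2 ⟨by linarith, by linarith⟩) hr0.le
    · have h1 : c * r ≤ ((3 * r : ℕ) : ℝ) := by
        push_cast
        exact mul_le_mul_of_nonneg_right hc hr0.le
      rw [cutoff_eq_zero hr (h1.trans (by exact_mod_cast (by omega))),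
        cutoff_eq_zero hr (h1.trans (by exact_mod_cast (by omega)))]
      simp [hd]
  calc pairEnergy P d (cutoff Γ x r c)
      ≤ ∑ p ∈ P, if Γ.dist x p.1 ≤ 3 * r then (1 / (r : ℝ)) ^ d else 0 := Finset.sum_le_sum hterm
    _ = Q.card * (1 / (r : ℝ)) ^ d := by rw [← Finset.sum_filter, Finset.sum_const, nsmul_eq_mul]
    _ ≤ Δ * (C * ((3 * r : ℕ) : ℝ) ^ d) * (1 / (r : ℝ)) ^ d :=
        mul_le_mul_of_nonneg_right hQ (by positivity)
    _ = Δ * (C * 3 ^ d) := by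
        push_cast
        rw [mul_pow, one_div, inv_pow]
        field_simp

/-! ### The greedy choice of test functions -/

/-- If every ball of radius `r - 1` carries less than `m` points of `B`, then a ball of radius `3 r`
carries at most a constant times `m`, by averaging over the centres of the small balls. -/
lemma card_inter_ball_le {V : Type*} {Γ : SimpleGraph V} (hΓ : Γ.Connected) {d : ℕ} {C : ℝ}
    (hC : 1 ≤ C)
    (hfin : ∀ x (n : ℕ), {y | Γ.dist x y ≤ n}.Finite)
    (hlow : ∀ x (n : ℕ), 1 ≤ n → C⁻¹ * (n : ℝ) ^ d ≤ ({y | Γ.dist x y ≤ n}.ncard : ℝ))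
    (hvol : ∀ x (n : ℕ), 1 ≤ n → ({y | Γ.dist x y ≤ n}.ncard : ℝ) ≤ C * (n : ℝ) ^ d)
    (B : Finset V) {m : ℝ} {r : ℕ} (hr : 1 ≤ r)
    (hB : ∀ y, ((B.filter fun z => Γ.dist y z ≤ r - 1).card : ℝ) ≤ m) (x : V) :
    ((B.filter fun z => Γ.dist x z ≤ 3 * r).card : ℝ) ≤ C ^ 2 * 8 ^ d * m := by
  classical
  have hC0 : 0 < C := by linarith
  have hr0 : (0 : ℝ) < r := by exact_mod_cast hr
  set D := B.filter fun z => Γ.dist x z ≤ 3 * r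
  set F := (hfin x (4 * r)).toFinset
  have hFmem : ∀ y, y ∈ F ↔ Γ.dist x y ≤ 4 * r := fun y => by simp [F]
  have hFcard : (F.card : ℝ) ≤ C * (4 * r) ^ d := by
    have := hvol x (4 * r) (by omega)
    rw [Set.ncard_eq_toFinset_card _ (hfin x (4 * r))] at this
    simpa using this
  have hm0 : 0 ≤ m := le_trans (by positivity) (hB x)
  have hsmall : ∀ z, C⁻¹ * ((r : ℝ) / 2) ^ d ≤ ({y | Γ.dist z y ≤ r - 1}.ncard : ℝ) := by
    intro z
    rcases Nat.lt_or_ge r 2 with h | h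
    · have h1 : r = 1 := by omega
      subst h1
      have h2 : 1 ≤ {y | Γ.dist z y ≤ 1 - 1}.ncard :=
        (Set.ncard_pos (hfin z _)).2 ⟨z, by simp⟩
      have h3 : C⁻¹ * (((1 : ℕ) : ℝ) / 2) ^ d ≤ 1 :=
        mul_le_one₀ (inv_le_one_of_one_le₀ hC) (by positivity)
          (pow_le_one₀ (by norm_num) (by norm_num))
      exact h3.trans (by exact_mod_cast h2)
    · refine le_trans ?_ (hlow z (r - 1) (by omega))
      refine mul_le_mul_of_nonneg_left (pow_le_pow_left₀ (by positivity) ?_ d) (by positivity)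
      rw [Nat.cast_sub hr]
      have : (2 : ℝ) ≤ r := by exact_mod_cast h
      push_cast
      linarith
  have hcount : ∑ z ∈ D, (F.filter fun y => Γ.dist y z ≤ r - 1).card =
      ∑ y ∈ F, (D.filter fun z => Γ.dist y z ≤ r - 1).card :=
    Finset.sum_card_bipartiteAbove_eq_sum_card_bipartiteBelow _
  have h1 : (D.card : ℝ) * (C⁻¹ * ((r : ℝ) / 2) ^ d) ≤
      ∑ z ∈ D, ((F.filter fun y => Γ.dist y z ≤ r - 1).card : ℝ) := by
    rw [← nsmul_eq_mul]
    refine Finset.card_nsmul_le_sum _ _ _ fun z hz => (hsmall z).trans ?_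
    rw [← Set.ncard_coe_finset]
    refine Nat.cast_le.2 (Set.ncard_le_ncard (fun y hy => ?_) (Finset.finite_toSet _))
    have hzx : Γ.dist x z ≤ 3 * r := (Finset.mem_filter.1 hz).2
    have hyz : Γ.dist z y ≤ r - 1 := hy
    have := hΓ.dist_triangle (u := x) (v := z) (w := y)
    rw [Finset.mem_coe, Finset.mem_filter, hFmem, SimpleGraph.dist_comm (u := y)]
    exact ⟨by omega, hyz⟩
  have h2 : ∑ y ∈ F, ((D.filter fun z => Γ.dist y z ≤ r - 1).card : ℝ) ≤ F.card * m := by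
    rw [← nsmul_eq_mul]
    refine Finset.sum_le_card_nsmul _ _ _ fun y _ => le_trans ?_ (hB y)
    exact Nat.cast_le.2 (Finset.card_le_card
      (Finset.filter_subset_filter _ (Finset.filter_subset _ _)))
  have h3 : (D.card : ℝ) * (C⁻¹ * ((r : ℝ) / 2) ^ d) ≤ C * (4 * r) ^ d * m := by
    refine (h1.trans (le_of_eq_of_le ?_ h2)).trans (mul_le_mul_of_nonneg_right hFcard hm0)
    exact_mod_cast hcount
  have h4 : 0 < C⁻¹ * ((r : ℝ) / 2) ^ d := by positivity
  refine le_of_mul_le_mul_right (h3.trans_eq ?_) h4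
  rw [show (4 * (r : ℝ)) = 8 * (r / 2) by ring, mul_pow]
  field_simp

/-- Greedy construction: around a ball of minimal radius that carries `m` of the remaining points of
`B`, place a cut-off function, and remove a larger concentric ball. The function `h` is the cut-off
away from all the balls removed so far; cutting off with it makes the supports disjoint. -/
lemma exists_disjoint_testFunctions {V : Type*} {Γ : SimpleGraph V} (hΓ : Γ.Connected) {d : ℕ}
    (hd : d ≠ 0) {C : ℝ} (hC : 1 ≤ C)
    (hfin : ∀ x (n : ℕ), {y | Γ.dist x y ≤ n}.Finite)
    (hlow : ∀ x (n : ℕ), 1 ≤ n → C⁻¹ * (n : ℝ) ^ d ≤ ({y | Γ.dist x y ≤ n}.ncard : ℝ))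
    (hvol : ∀ x (n : ℕ), 1 ≤ n → ({y | Γ.dist x y ≤ n}.ncard : ℝ) ≤ C * (n : ℝ) ^ d)
    {P : Finset (V × V)} (hP : ∀ p ∈ P, Γ.Adj p.1 p.2) {Δ : ℕ}
    (hΔ : ∀ x, {p ∈ (P : Set (V × V)) | p.1 = x}.ncard ≤ Δ)
    (B : Finset V) {m : ℝ} (hm : 1 < m) (n : ℕ) (hn : n * (C ^ 2 * 8 ^ d * m) ≤ B.card) :
    ∃ (f : ℕ → V → ℝ) (h : V → ℝ),
      (∀ i < n, pairEnergy P d (f i) ≤ n * (Δ * (C * 3 ^ d))) ∧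
      (∀ i < n, m ≤ (B.filter fun b => f i b = 1).card) ∧
      (∀ i < n, ∀ j < n, i ≠ j → ∀ x, f i x = 0 ∨ f j x = 0) ∧
      (∀ i < n, ∀ x, f i x = 0 ∨ h x = 0) ∧
      (∀ x, 0 ≤ h x ∧ h x ≤ 1) ∧
      pairEnergy P d h ≤ n * (Δ * (C * 3 ^ d)) ∧
      ((B.filter fun b => ¬ h b = 1).card : ℝ) ≤ n * (C ^ 2 * 8 ^ d * m) := by
  classical
  have hM1 : 1 ≤ C ^ 2 * 8 ^ d :=
    one_le_mul_of_one_le_of_one_le (one_le_pow₀ hC) (one_le_pow₀ (by norm_num))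
  have hm0 : 0 < m := by linarith
  set E := Δ * (C * 3 ^ d)
  have hE : 0 ≤ E := by positivity
  induction n with
  | zero => exact ⟨fun _ _ => 0, fun _ => 1, by simp, by simp, by simp, by simp, by simp,
      by simp [pairEnergy, hd], by simp⟩
  | succ n ih =>
    push_cast at hn ⊢
    have hMm : m ≤ C ^ 2 * 8 ^ d * m := le_mul_of_one_le_left hm0.le hM1
    obtain ⟨f, h, hfE, hfm, hff, hfh, h01, hhE, hhm⟩ := ih (by linarith)
    set B' := B.filter fun b => h b = 1
    have hB' : m ≤ B'.card := by
      have h1 := Finset.card_filter_add_card_filter_not (s := B) fun b => h b = 1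
      have h2 : (B'.card : ℝ) + (B.filter fun b => ¬ h b = 1).card = B.card := by
        exact_mod_cast h1
      linarith
    have hex : ∃ r : ℕ, ∃ x, m ≤ ((B'.filter fun z => Γ.dist x z ≤ r).card : ℝ) := by
      obtain ⟨x⟩ := hΓ.nonempty
      refine ⟨B'.sup (Γ.dist x), x, ?_⟩
      rwa [Finset.filter_true_of_mem fun z hz => Finset.le_sup hz]
    obtain ⟨x, hx⟩ := Nat.find_spec hex
    have hmin : ∀ r', r' < Nat.find hex → ∀ y,
        ((B'.filter fun z => Γ.dist y z ≤ r').card : ℝ) ≤ m := by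
      intro r' hr' y
      by_contra hcon
      exact Nat.find_min hex hr' ⟨y, (not_le.1 hcon).le⟩
    set r := Nat.find hex
    -- A ball of radius `0` carries at most one point, and `1 < m`.
    have hr : 1 ≤ r := by
      by_contra hr
      have hr0 : r = 0 := by omega
      have h1 : (B'.filter fun z => Γ.dist x z ≤ r).card ≤ 1 := by
        refine Finset.card_le_one.2 fun a ha b hb => ?_
        rw [hr0] at ha hb
        have ha' := hΓ.dist_eq_zero_iff.1 (Nat.le_zero.1 (Finset.mem_filter.1 ha).2)
        have hb' := hΓ.dist_eq_zero_iff.1 (Nat.le_zero.1 (Finset.mem_filter.1 hb).2)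
        exact ha'.symm.trans hb'
      have h2 : ((B'.filter fun z => Γ.dist x z ≤ r).card : ℝ) ≤ 1 := by exact_mod_cast h1
      linarith
    have hr0 : (0 : ℝ) < r := by exact_mod_cast hr
    have hbig := card_inter_ball_le hΓ hC hfin hlow hvol B' hr (hmin (r - 1) (by omega)) x
    have hcut := fun c hc =>
      pairEnergy_cutoff_le hΓ hd hfin hvol hP hΔ x hr (c := c) hc
    set φ := cutoff Γ x r 2
    set ψ := cutoff Γ x r 3
    -- The support of `φ` lies in the ball where `ψ = 1`.
    have hφψ : ∀ y, φ y = 0 ∨ 1 - ψ y = 0 := by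
      intro y
      rcases le_total ((Γ.dist x y : ℝ)) (2 * r) with hy | hy
      · exact Or.inr (by rw [show ψ y = 1 from cutoff_eq_one hr (by linarith), sub_self])
      · exact Or.inl (cutoff_eq_zero hr hy)
    have hφ0 : ∀ y, 0 ≤ φ y := cutoff_nonneg Γ x r 2
    have hψ1 : ∀ y, ψ y ≤ 1 := cutoff_le_one Γ x r 3
    have hnew : ∀ i < n, ∀ y, f i y = 0 ∨ min (φ y) (h y) = 0 := fun i hi y =>
      (hfh i hi y).imp_right fun hy => by rw [hy, min_eq_right (hφ0 y)]
    refine ⟨fun i => if i = n then fun y => min (φ y) (h y) else f i,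
      fun y => min (1 - ψ y) (h y), fun i hi => ?_, fun i hi => ?_, fun i hi j hj hij y => ?_,
      fun i hi y => ?_, fun y => ?_, ?_, ?_⟩
    · dsimp only
      split_ifs with hin
      · refine (pairEnergy_min_le P d _ _).trans ?_
        linarith [hcut 2 (by norm_num)]
      · linarith [hfE i (by omega)]
    · dsimp only
      split_ifs with hin
      · refine hx.trans (Nat.cast_le.2 (Finset.card_le_card fun z hz => ?_))
        rw [Finset.mem_filter, Finset.mem_filter] at hz
        rw [Finset.mem_filter]
        refine ⟨hz.1.1, ?_⟩
        dsimp only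
        rw [hz.1.2, show φ z = 1 from cutoff_eq_one hr ?_, min_self]
        have : (Γ.dist x z : ℝ) ≤ r := by exact_mod_cast hz.2
        linarith
      · exact hfm i (by omega)
    · by_cases hin : i = n
      · have hjn : j ≠ n := fun h => hij (hin.trans h.symm)
        simp only [hin, if_true, if_neg hjn]
        exact (hnew j (by omega) y).symm
      · by_cases hjn : j = n
        · simp only [hjn, if_true, if_neg hin]
          exact hnew i (by omega) y
        · simp only [if_neg hin, if_neg hjn]
          exact hff i (by omega) j (by omega) hij y
    · dsimp only
      split_ifs with hin
      · rcases hφψ y with hy | hy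
        · exact Or.inl (by dsimp only; rw [hy, min_eq_left (h01 y).1])
        · exact Or.inr (by rw [hy, min_eq_left (h01 y).1])
      · refine (hfh i (by omega) y).imp_right fun hy => ?_
        rw [hy, min_eq_right (by linarith [hψ1 y])]
    · exact ⟨le_min (by linarith [hψ1 y]) (h01 y).1, (min_le_right _ _).trans (h01 y).2⟩
    · refine (pairEnergy_min_le P d _ _).trans ?_
      rw [pairEnergy_one_sub]
      linarith [hcut 3 le_rfl]
    · have hsub : (B.filter fun b => ¬ min (1 - ψ b) (h b) = 1) ⊆
          (B.filter fun b => ¬ h b = 1) ∪ (B'.filter fun z => Γ.dist x z ≤ 3 * r) := by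
        intro b hb
        rw [Finset.mem_filter] at hb
        rw [Finset.mem_union, Finset.mem_filter, Finset.mem_filter, Finset.mem_filter]
        by_cases hb1 : h b = 1
        · refine Or.inr ⟨⟨hb.1, hb1⟩, ?_⟩
          by_contra hfar
          have h3 : (3 : ℝ) * r ≤ Γ.dist x b := by exact_mod_cast (not_le.1 hfar).le
          exact hb.2 (by rw [hb1, show ψ b = 0 from cutoff_eq_zero hr h3, sub_zero, min_self])
        · exact Or.inl ⟨hb.1, hb1⟩
      have h1 := (Finset.card_le_card hsub).trans (Finset.card_union_le _ _)
      have h2 : ((B.filter fun b => ¬ min (1 - ψ b) (h b) = 1).card : ℝ) ≤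
          (B.filter fun b => ¬ h b = 1).card +
            (B'.filter fun z => Γ.dist x z ≤ 3 * r).card := by exact_mod_cast h1
      linarith

/-! ### Balls in the Cayley graph -/

lemma mulCayley_connected {G : Type*} [Group G] {S : Set G} (hgen : Subgroup.closure S = ⊤) :
    (SimpleGraph.mulCayley S).Connected := by
  have hstep : ∀ x, ∀ s ∈ S, (SimpleGraph.mulCayley S).Reachable x (x * s) := by
    intro x s hs
    by_cases h : x = x * s
    · rw [← h]
    · exact SimpleGraph.Adj.reachable
        ((SimpleGraph.mulCayley_adj' S x (x * s)).2 ⟨h, s, hs, Or.inl rfl⟩)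
  have h1 : ∀ g, (SimpleGraph.mulCayley S).Reachable 1 g := by
    intro g
    have hg : g ∈ Subgroup.closure S := hgen ▸ Subgroup.mem_top g
    induction hg using Subgroup.closure_induction_right with
    | one => exact SimpleGraph.Reachable.refl _
    | mul_right x _ s hs ih => exact ih.trans (hstep x s hs)
    | mul_inv_cancel x _ s hs ih =>
      refine ih.trans (SimpleGraph.Reachable.symm ?_)
      simpa using hstep (x * s⁻¹) s hs
  exact (SimpleGraph.connected_iff _).2 ⟨fun x y => (h1 x).symm.trans (h1 y), ⟨1⟩⟩

lemma mulCayley_dist_mul_left {G : Type*} [Group G] {S : Set G}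
    (hΓ : (SimpleGraph.mulCayley S).Connected) (g x y : G) :
    (SimpleGraph.mulCayley S).dist (g * x) (g * y) = (SimpleGraph.mulCayley S).dist x y := by
  have hle : ∀ g x y : G,
      (SimpleGraph.mulCayley S).dist (g * x) (g * y) ≤ (SimpleGraph.mulCayley S).dist x y := by
    intro g x y
    obtain ⟨p, hp⟩ := hΓ.exists_walk_length_eq_dist x y
    let φ : SimpleGraph.mulCayley S →g SimpleGraph.mulCayley S :=
      ⟨(g * ·), fun h => SimpleGraph.mulCayley_adj_mul_iff_right.2 h⟩
    have := SimpleGraph.dist_le (p.map φ)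
    rwa [SimpleGraph.Walk.length_map, hp] at this
  refine le_antisymm (hle g x y) ?_
  simpa using hle g⁻¹ (g * x) (g * y)

lemma mulCayley_ncard_ball {G : Type*} [Group G] {S : Set G}
    (hΓ : (SimpleGraph.mulCayley S).Connected) (x : G) (n : ℕ) :
    {y | (SimpleGraph.mulCayley S).dist x y ≤ n}.ncard =
      {g | (SimpleGraph.mulCayley S).edist 1 g ≤ n}.ncard := by
  rw [← Set.ncard_image_of_injective {g | (SimpleGraph.mulCayley S).edist 1 g ≤ n}
    (mul_right_injective x)]
  congr 1
  ext y
  simp only [Set.mem_ofPred_eq, Set.mem_image]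
  constructor
  · intro h
    refine ⟨x⁻¹ * y, ?_, by group⟩
    rw [← (hΓ.preconnected _ _).coe_dist_eq_edist, Nat.cast_le,
      ← mulCayley_dist_mul_left hΓ x]
    simpa using h
  · rintro ⟨g, hg, rfl⟩
    rw [← (hΓ.preconnected _ _).coe_dist_eq_edist, Nat.cast_le,
      ← mulCayley_dist_mul_left hΓ x] at hg
    simpa using hg

lemma mulCayley_ncard_fiber_le {G : Type*} [Group G] {S : Finset G}
    (hsymm : ∀ s ∈ S, s⁻¹ ∈ S) {P : Finset (G × G)}
    (hP : ∀ p ∈ P, (SimpleGraph.mulCayley (S : Set G)).Adj p.1 p.2) (x : G) :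
    {p ∈ (P : Set (G × G)) | p.1 = x}.ncard ≤ S.card := by
  rw [← Set.ncard_coe_finset S]
  refine Set.ncard_le_ncard_of_injOn (fun p => x⁻¹ * p.2) ?_ ?_ S.finite_toSet
  · rintro p ⟨hp, rfl⟩
    rcases ((SimpleGraph.mulCayley_adj _ _ _).1 (hP p hp)).2 with h | h
    · exact h
    · simpa using hsymm _ h
  · rintro p ⟨-, hp⟩ q ⟨-, hq⟩ hpq
    exact Prod.ext (hp.trans hq.symm) (mul_left_cancel hpq)

/-! ### The isoperimetric inequality -/

/-- Right translation along an edge moves a point of `Ω` out of `Ω` at most `|B|` times, so a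
translation by an element of length `ℓ` moves at most `ℓ |B|` points out. -/
lemma card_translate_notMem_le {G : Type*} [Group G] {S : Finset G} (Ω : Finset G)
    {u v : G} (p : (SimpleGraph.mulCayley (S : Set G)).Walk u v) :
    {x ∈ (Ω : Set G) | x * v ∉ Ω}.ncard ≤ {x ∈ (Ω : Set G) | x * u ∉ Ω}.ncard +
      p.length * (vertexBoundary (SimpleGraph.mulCayley (S : Set G)) Ω).card := by
  induction p with
  | nil => simp
  | @cons u w v hadj p ih =>
    have hstep : {x ∈ (Ω : Set G) | x * w ∉ Ω}.ncard ≤ {x ∈ (Ω : Set G) | x * u ∉ Ω}.ncard +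
        (vertexBoundary (SimpleGraph.mulCayley (S : Set G)) Ω).card := by
      have hfin : ∀ q : G → Prop, {x ∈ (Ω : Set G) | q x}.Finite :=
        fun q => Ω.finite_toSet.subset (Set.sep_subset _ _)
      have hsub : {x ∈ (Ω : Set G) | x * w ∉ Ω} ⊆ {x ∈ (Ω : Set G) | x * u ∉ Ω} ∪
          {x ∈ (Ω : Set G) | x * u ∈ Ω ∧ x * w ∉ Ω} := by
        rintro x ⟨hx, hxw⟩
        by_cases hxu : x * u ∈ Ω
        · exact Or.inr ⟨hx, hxu, hxw⟩
        · exact Or.inl ⟨hx, hxu⟩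
      refine (Set.ncard_le_ncard hsub ((hfin _).union (hfin _))).trans
        ((Set.ncard_union_le _ _).trans (Nat.add_le_add_left ?_ _))
      rw [← Set.ncard_coe_finset]
      refine Set.ncard_le_ncard_of_injOn (fun x => x * w) ?_ ?_ (Finset.finite_toSet _)
      · rintro x ⟨-, hxu, hxw⟩
        exact mem_vertexBoundary.2 ⟨hxw, x * u, hxu, SimpleGraph.mulCayley_adj_mul_iff_right.2 hadj⟩
      · intro x _ y _ hxy
        exact mul_right_cancel hxy
    rw [SimpleGraph.Walk.length_cons, add_mul, one_mul]
    omega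

/-- The isoperimetric inequality `|Ω| ^ (d - 1) ≤ const |B| ^ d`. Averaged over a ball with at least
`2 |Ω|` elements, a right translation moves half of `Ω` out of `Ω`. -/
lemma card_pow_le_card_vertexBoundary_pow {G : Type*} [Group G] {S : Finset G}
    (hΓ : (SimpleGraph.mulCayley (S : Set G)).Connected) {d : ℕ} (hd : d ≠ 0) {C : ℝ} (hC : 1 ≤ C)
    (hfin : ∀ (n : ℕ), {y | (SimpleGraph.mulCayley (S : Set G)).dist 1 y ≤ n}.Finite)
    (hlow : ∀ (n : ℕ), 1 ≤ n → C⁻¹ * (n : ℝ) ^ d ≤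
      ({y | (SimpleGraph.mulCayley (S : Set G)).dist 1 y ≤ n}.ncard : ℝ))
    (Ω : Finset G) (hΩ : Ω.Nonempty) :
    (Ω.card : ℝ) ^ (d - 1) ≤ 2 * C * 4 ^ d *
      ((vertexBoundary (SimpleGraph.mulCayley (S : Set G)) Ω).card : ℝ) ^ d := by
  classical
  set Γ := SimpleGraph.mulCayley (S : Set G)
  set b := (vertexBoundary Γ Ω).card
  have hC0 : 0 < C := by linarith
  have hΩ1 : (1 : ℝ) ≤ Ω.card := by exact_mod_cast hΩ.card_pos
  -- The least radius `n` at which the growth bound gives a ball with `2 |Ω|` elements.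
  have hex : ∃ n : ℕ, 2 * C * Ω.card ≤ (n : ℝ) ^ d := by
    obtain ⟨n, hn⟩ := exists_nat_ge (2 * C * (Ω.card : ℝ))
    refine ⟨n + 1, hn.trans ?_⟩
    have : (n : ℝ) ≤ (n + 1 : ℕ) := by push_cast; linarith
    refine this.trans (le_self_pow₀ (by push_cast; linarith [(Nat.cast_nonneg n : (0 : ℝ) ≤ n)]) hd)
  have hn := Nat.find_spec hex
  have hmin : ∀ j, j < Nat.find hex → (j : ℝ) ^ d ≤ 2 * C * Ω.card :=
    fun j hj => (not_le.1 (Nat.find_min hex hj)).le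
  set n := Nat.find hex
  have hn1 : 1 ≤ n := by
    by_contra h
    have h0 : n = 0 := by omega
    rw [h0, Nat.cast_zero, zero_pow hd] at hn
    nlinarith
  have hnd : (n : ℝ) ^ d ≤ 2 ^ d * (2 * C * Ω.card) := by
    rcases Nat.lt_or_ge n 2 with h | h
    · have h1 : n = 1 := by omega
      rw [h1, Nat.cast_one, one_pow]
      exact one_le_mul_of_one_le_of_one_le (one_le_pow₀ (by norm_num)) (by nlinarith)
    · refine le_trans ?_ (mul_le_mul_of_nonneg_left (hmin (n - 1) (by omega)) (by positivity))
      rw [← mul_pow]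
      refine pow_le_pow_left₀ (by positivity) ?_ d
      exact_mod_cast (by omega : n ≤ 2 * (n - 1))
  set F := (hfin n).toFinset
  have hF : 2 * (Ω.card : ℝ) ≤ F.card := by
    have h1 := hlow n hn1
    rw [Set.ncard_eq_toFinset_card _ (hfin n)] at h1
    refine le_trans ?_ h1
    rw [le_inv_mul_iff₀ hC0]
    linarith
  have hcount : ∑ g ∈ F, (Ω.filter fun x => x * g ∉ Ω).card =
      ∑ x ∈ Ω, (F.filter fun g => x * g ∉ Ω).card :=
    (Finset.sum_card_bipartiteAbove_eq_sum_card_bipartiteBelow fun x g => x * g ∉ Ω).symm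
  have hup : ∑ g ∈ F, (Ω.filter fun x => x * g ∉ Ω).card ≤ F.card * (n * b) := by
    rw [← smul_eq_mul]
    refine Finset.sum_le_card_nsmul _ _ _ fun g hg => ?_
    obtain ⟨p, hp⟩ := hΓ.exists_walk_length_eq_dist 1 g
    have h1 := card_translate_notMem_le Ω p
    have h2 : {x ∈ (Ω : Set G) | x * 1 ∉ Ω} = ∅ := by ext; simp
    rw [h2, Set.ncard_empty, zero_add, hp] at h1
    have h3 : (Ω.filter fun x => x * g ∉ Ω).card = {x ∈ (Ω : Set G) | x * g ∉ Ω}.ncard := by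
      rw [← Set.ncard_coe_finset]
      congr 1
      ext; simp
    rw [h3]
    exact h1.trans (Nat.mul_le_mul_right _ (by simpa [F] using hg))
  have hdown : Ω.card * F.card ≤ ∑ x ∈ Ω, (F.filter fun g => x * g ∉ Ω).card +
      Ω.card * Ω.card := by
    have : ∀ x ∈ Ω, F.card ≤ (F.filter fun g => x * g ∉ Ω).card + Ω.card := by
      intro x _
      rw [← Finset.card_filter_add_card_filter_not (s := F) fun g => x * g ∉ Ω]
      refine Nat.add_le_add_left ?_ _
      refine Finset.card_le_card_of_injOn (fun g => x * g) (fun g hg => ?_)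
        fun g _ g' _ h => mul_left_cancel h
      simpa using (Finset.mem_filter.1 hg).2
    have h := Finset.sum_le_sum this
    simpa [Finset.sum_add_distrib] using h
  have hmain : (Ω.card : ℝ) ≤ 2 * n * b := by
    have h1 : (Ω.card : ℝ) * F.card ≤ F.card * (n * b) + Ω.card * Ω.card := by
      exact_mod_cast hdown.trans (Nat.add_le_add_right (hcount ▸ hup) _)
    have hF0 : (0 : ℝ) < F.card := by linarith
    have h2 : (Ω.card : ℝ) * Ω.card ≤ Ω.card * (F.card / 2) :=
      mul_le_mul_of_nonneg_left (by linarith) (by positivity)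
    refine le_of_mul_le_mul_right (?_ : _ ≤ _ * (F.card : ℝ)) hF0
    nlinarith
  have hpow := pow_le_pow_left₀ (by positivity) hmain d
  have hfinal : (Ω.card : ℝ) ^ (d - 1) * Ω.card ≤ 2 * C * 4 ^ d * (b : ℝ) ^ d * Ω.card := by
    rw [← pow_succ, Nat.sub_add_cancel (Nat.one_le_iff_ne_zero.2 hd)]
    calc (Ω.card : ℝ) ^ d ≤ 2 ^ d * (n : ℝ) ^ d * (b : ℝ) ^ d := by
          rwa [mul_pow, mul_pow] at hpow
      _ ≤ 2 ^ d * (2 ^ d * (2 * C * Ω.card)) * (b : ℝ) ^ d := by gcongr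
      _ = _ := by
          rw [show (4 : ℝ) = 2 * 2 by norm_num, mul_pow]
          ring
  exact le_of_mul_le_mul_right hfinal (by linarith)

/-! ### Functions on the subgraph -/

lemma boundarySubgraph_connected {V : Type*} {Γ : SimpleGraph V} [Γ.LocallyFinite]
    {Ω : Finset V} (hΩ : (Γ.induce (Ω : Set V)).Connected) :
    (boundarySubgraph Γ Ω).Connected := by
  have hmem : ∀ x ∈ Ω, x ∈ vertexClosure Γ Ω := fun x hx => by
    classical exact Finset.mem_union_left _ hx
  let φ : Γ.induce (Ω : Set V) →g boundarySubgraph Γ Ω :=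
    ⟨fun x => ⟨x.1, hmem x.1 x.2⟩, fun {x _} h => ⟨h, Or.inl x.2⟩⟩
  have hreach : ∀ w : vertexClosure Γ Ω, ∃ x : (Ω : Set V),
      (boundarySubgraph Γ Ω).Reachable (φ x) w := by
    rintro ⟨w, hw⟩
    by_cases hwΩ : w ∈ Ω
    · exact ⟨⟨w, hwΩ⟩, SimpleGraph.Reachable.refl _⟩
    · have hwB : w ∈ vertexBoundary Γ Ω := by
        classical exact (Finset.mem_union.1 hw).resolve_left hwΩ
      obtain ⟨-, x, hx, hadj⟩ := mem_vertexBoundary.1 hwB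
      exact ⟨⟨x, hx⟩, SimpleGraph.Adj.reachable ⟨hadj, Or.inl hx⟩⟩
  obtain ⟨x0⟩ := hΩ.nonempty
  refine (SimpleGraph.connected_iff _).2 ⟨fun u v => ?_, ⟨φ x0⟩⟩
  obtain ⟨x, hx⟩ := hreach u
  obtain ⟨y, hy⟩ := hreach v
  exact hx.symm.trans (((hΩ.preconnected x y).map φ).trans hy)

lemma sum_subtype_vertexBoundary {V : Type*} (Γ : SimpleGraph V) [Γ.LocallyFinite]
    (Ω : Finset V) [DecidablePred (· ∈ vertexClosure Γ Ω)] (g : V → ℝ) :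
    ∑ b ∈ (vertexBoundary Γ Ω).subtype (· ∈ vertexClosure Γ Ω), g b =
      ∑ b ∈ vertexBoundary Γ Ω, g b := by
  refine Finset.sum_subtype_of_mem g fun x hx => ?_
  classical exact Finset.mem_union_right _ hx

open scoped Classical in
/-- The pairs of adjacent vertices of `(Ω, B)`; each edge occurs in both orientations. -/
noncomputable def boundaryPairs {V : Type*} (Γ : SimpleGraph V) [Γ.LocallyFinite]
    (Ω : Finset V) : Finset (V × V) :=
  (vertexClosure Γ Ω ×ˢ vertexClosure Γ Ω).filter fun p => Γ.Adj p.1 p.2 ∧ (p.1 ∈ Ω ∨ p.2 ∈ Ω)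

lemma adj_of_mem_boundaryPairs {V : Type*} {Γ : SimpleGraph V} [Γ.LocallyFinite]
    {Ω : Finset V} {p : V × V} (hp : p ∈ boundaryPairs Γ Ω) : Γ.Adj p.1 p.2 := by
  classical exact (Finset.mem_filter.1 hp).2.1

lemma card_boundaryPairs_le {V : Type*} {Γ : SimpleGraph V} [Γ.LocallyFinite]
    {Ω : Finset V} {Δ : ℕ}
    (hΔ : ∀ x, {p ∈ (boundaryPairs Γ Ω : Set (V × V)) | p.1 = x}.ncard ≤ Δ) :
    (boundaryPairs Γ Ω).card ≤ Δ * (Ω.card + (vertexBoundary Γ Ω).card) := by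
  classical
  refine le_trans ?_ (Nat.mul_le_mul_left Δ (Finset.card_union_le Ω (vertexBoundary Γ Ω)))
  refine Finset.card_le_mul_card_image_of_maps_to (f := Prod.fst) (fun p hp => ?_) Δ fun x _ => ?_
  · have := (Finset.mem_product.1 (Finset.mem_filter.1 hp).1).1
    exact this
  · refine le_trans (le_of_eq ?_) (hΔ x)
    rw [← Set.ncard_coe_finset]
    congr 1
    ext; simp

lemma sum_graphLaplacian_boundarySubgraph {V : Type*} (Γ : SimpleGraph V) [Γ.LocallyFinite]
    (Ω : Finset V) (g : V → ℝ) :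
    ∑ x, graphLaplacian (boundarySubgraph Γ Ω) (fun y => g y) x * g x =
      (∑ p ∈ boundaryPairs Γ Ω, (g p.1 - g p.2) * (g p.1 - g p.2)) / 2 := by
  classical
  rw [sum_graphLaplacian_mul (boundarySubgraph Γ Ω) (fun y => g y) (fun y => g y)]
  congr 1
  rw [boundaryPairs, Finset.sum_filter, Finset.sum_product,
    ← Finset.sum_coe_sort (vertexClosure Γ Ω)]
  refine Finset.sum_congr rfl fun x _ => ?_
  rw [← Finset.sum_coe_sort (vertexClosure Γ Ω)]
  refine Finset.sum_congr rfl fun y _ => ?_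
  congr!

/-! ### Bounds on Steklov eigenvalues of subgraphs -/

lemma card_subtype_vertexBoundary {V : Type*} (Γ : SimpleGraph V) [Γ.LocallyFinite]
    (Ω : Finset V) [DecidablePred (· ∈ vertexClosure Γ Ω)] :
    ((vertexBoundary Γ Ω).subtype (· ∈ vertexClosure Γ Ω)).card = (vertexBoundary Γ Ω).card := by
  classical
  have h : ∀ x ∈ vertexBoundary Γ Ω, x ∈ vertexClosure Γ Ω :=
    fun x hx => Finset.mem_union_right _ hx
  rw [Finset.card_subtype, Finset.filter_true_of_mem h]

/-- The min-max bound for test functions on the ambient graph that equal `1` at `m` boundary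
vertices. -/
lemma subgraphSteklovEigenvalue_le_of_disjoint {V : Type*} {Γ : SimpleGraph V} [Γ.LocallyFinite]
    {Ω : Finset V} (hΩ : (Γ.induce (Ω : Set V)).Connected) {k : ℕ}
    (hk : k < (vertexBoundary Γ Ω).card) {E m : ℝ} (hm : 0 < m) (f : ℕ → V → ℝ)
    (hdisj : ∀ i < k + 1, ∀ j < k + 1, i ≠ j → ∀ x, f i x = 0 ∨ f j x = 0)
    (hE : ∀ i < k + 1, ∑ p ∈ boundaryPairs Γ Ω,
      (f i p.1 - f i p.2) * (f i p.1 - f i p.2) ≤ E)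
    (hmass : ∀ i < k + 1, m ≤ {b ∈ (vertexBoundary Γ Ω : Set V) | f i b = 1}.ncard) :
    subgraphSteklovEigenvalue Γ Ω k ≤ E / m := by
  classical
  rw [subgraphSteklovEigenvalue, show E = 2 * (E / 2) by ring]
  refine steklovEigenvalue_le_of_disjoint (boundarySubgraph_connected hΩ)
    (by rwa [card_subtype_vertexBoundary]) hm (fun i x => f i x)
    (fun i j hij x => hdisj i i.2 j j.2 (fun h => hij (Fin.ext h)) x) (fun i => ?_) fun i => ?_
  · rw [sum_graphLaplacian_boundarySubgraph Γ Ω (f i)]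
    exact div_le_div_of_nonneg_right (hE i i.2) two_pos.le
  · rw [sum_subtype_vertexBoundary Γ Ω fun b => f i b * f i b]
    refine (hmass i i.2).trans ?_
    have h1 : {b ∈ (vertexBoundary Γ Ω : Set V) | f i b = 1}.ncard =
        ((vertexBoundary Γ Ω).filter fun b => f i b = 1).card := by
      rw [← Set.ncard_coe_finset]
      congr 1
      ext; simp
    rw [h1, Finset.card_filter, Nat.cast_sum]
    refine Finset.sum_le_sum fun b _ => ?_
    split_ifs with h
    · simp [h]
    · simpa using mul_self_nonneg (f i b)

/-- The bound by point masses at boundary vertices. -/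
lemma subgraphSteklovEigenvalue_le_degree {V : Type*} {Γ : SimpleGraph V} [Γ.LocallyFinite]
    {Ω : Finset V} (hΩ : (Γ.induce (Ω : Set V)).Connected) {k : ℕ}
    (hk : k < (vertexBoundary Γ Ω).card) {Δ : ℕ}
    (hΔ : ∀ x, {p ∈ (boundaryPairs Γ Ω : Set (V × V)) | p.1 = x}.ncard ≤ Δ)
    (hΔ' : ∀ x, {p ∈ (boundaryPairs Γ Ω : Set (V × V)) | p.2 = x}.ncard ≤ Δ) :
    subgraphSteklovEigenvalue Γ Ω k ≤ 2 * Δ := by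
  classical
  set B := vertexBoundary Γ Ω
  let e : ℕ → V := fun i => if h : i < B.card then B.equivFin.symm ⟨i, h⟩ else
    (B.equivFin.symm ⟨k, hk⟩ : V)
  have he : ∀ i (h : i < B.card), e i = B.equivFin.symm ⟨i, h⟩ := fun i h => dif_pos h
  have hinj : ∀ i < k + 1, ∀ j < k + 1, i ≠ j → e i ≠ e j := by
    intro i hi j hj hij h
    rw [he i (by omega), he j (by omega)] at h
    simp [hij] at h
  rw [← div_one (2 * (Δ : ℝ))]
  refine subgraphSteklovEigenvalue_le_of_disjoint hΩ hk one_pos (fun i => Pi.single (e i) 1)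
    (fun i hi j hj hij x => ?_) (fun i hi => ?_) fun i hi => ?_
  · by_cases hx : x = e i
    · exact Or.inr (Pi.single_eq_of_ne (by rw [hx]; exact hinj i hi j hj hij) _)
    · exact Or.inl (Pi.single_eq_of_ne hx _)
  · set g : V → ℝ := Pi.single (e i) 1
    have hg : ∀ x, g x = if x = e i then 1 else 0 := fun x => by simp [g, Pi.single_apply]
    have hcard : ∀ q : V × V → V,
        (∀ x, {p ∈ (boundaryPairs Γ Ω : Set (V × V)) | q p = x}.ncard ≤ Δ) →
        ∑ p ∈ boundaryPairs Γ Ω, g (q p) ≤ Δ := by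
      intro q hq
      simp only [hg, Finset.sum_boole]
      refine Nat.cast_le.2 (le_trans (le_of_eq ?_) (hq (e i)))
      rw [← Set.ncard_coe_finset]
      congr 1
      ext; simp
    calc ∑ p ∈ boundaryPairs Γ Ω, (g p.1 - g p.2) * (g p.1 - g p.2)
        ≤ ∑ p ∈ boundaryPairs Γ Ω, (g p.1 + g p.2) := by
          refine Finset.sum_le_sum fun p _ => ?_
          rw [hg, hg]
          split_ifs <;> norm_num
      _ ≤ 2 * Δ := by
          rw [Finset.sum_add_distrib]
          linarith [hcard Prod.fst hΔ, hcard Prod.snd hΔ']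
  · have hmem : e i ∈ {b ∈ (B : Set V) | (Pi.single (e i) (1 : ℝ) : V → ℝ) b = 1} := by
      refine ⟨?_, by simp⟩
      rw [he i (by omega)]
      exact (B.equivFin.symm _).2
    have := (Set.ncard_pos (B.finite_toSet.subset (Set.sep_subset _ _))).2 ⟨_, hmem⟩
    exact_mod_cast this

lemma subgraphSteklovEigenvalue_zero_le {V : Type*} {Γ : SimpleGraph V} [Γ.LocallyFinite]
    {Ω : Finset V} (hΩ : (Γ.induce (Ω : Set V)).Connected)
    (hB : 0 < (vertexBoundary Γ Ω).card) : subgraphSteklovEigenvalue Γ Ω 0 ≤ 0 := by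
  have h := subgraphSteklovEigenvalue_le_of_disjoint (E := 0) (m := (vertexBoundary Γ Ω).card) hΩ hB
    (by exact_mod_cast hB) (fun _ _ => 1) (fun i hi j hj hij => absurd (by omega) hij)
    (by simp) (by simp [Set.ncard_coe_finset])
  simpa using h

/-- The bound by the test functions of the greedy construction, for `|B|` large compared
with `k`. -/
lemma subgraphSteklovEigenvalue_le_of_growth {V : Type*} {Γ : SimpleGraph V} [Γ.LocallyFinite]
    (hΓ : Γ.Connected) {d : ℕ} (hd : 2 ≤ d) {C : ℝ} (hC : 1 ≤ C)
    (hfin : ∀ x (n : ℕ), {y | Γ.dist x y ≤ n}.Finite)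
    (hlow : ∀ x (n : ℕ), 1 ≤ n → C⁻¹ * (n : ℝ) ^ d ≤ ({y | Γ.dist x y ≤ n}.ncard : ℝ))
    (hvol : ∀ x (n : ℕ), 1 ≤ n → ({y | Γ.dist x y ≤ n}.ncard : ℝ) ≤ C * (n : ℝ) ^ d)
    {Ω : Finset V} (hΩ : (Γ.induce (Ω : Set V)).Connected) {k : ℕ} {Δ : ℕ}
    (hΔ : ∀ x, {p ∈ (boundaryPairs Γ Ω : Set (V × V)) | p.1 = x}.ncard ≤ Δ)
    (hk : ((k + 1 : ℕ) : ℝ) * (C ^ 2 * 8 ^ d) < (vertexBoundary Γ Ω).card) :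
    subgraphSteklovEigenvalue Γ Ω k ≤
      ((boundaryPairs Γ Ω).card : ℝ) ^ (1 - 2 / (d : ℝ)) *
        (((k + 1 : ℕ) : ℝ) * (Δ * (C * 3 ^ d))) ^ (2 / (d : ℝ)) /
          ((vertexBoundary Γ Ω).card / (((k + 1 : ℕ) : ℝ) * (C ^ 2 * 8 ^ d))) := by
  classical
  have hM1 : 1 ≤ C ^ 2 * 8 ^ d :=
    one_le_mul_of_one_le_of_one_le (one_le_pow₀ hC) (one_le_pow₀ (by norm_num))
  have hK : (0 : ℝ) < ((k + 1 : ℕ) : ℝ) := by positivity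
  have hKM : 0 < ((k + 1 : ℕ) : ℝ) * (C ^ 2 * 8 ^ d) := by positivity
  have hkB : k < (vertexBoundary Γ Ω).card := by
    have : ((k + 1 : ℕ) : ℝ) < (vertexBoundary Γ Ω).card :=
      (le_mul_of_one_le_right hK.le hM1).trans_lt hk
    have : k + 1 < (vertexBoundary Γ Ω).card := by exact_mod_cast this
    omega
  -- Each of the `k + 1` greedy steps may use up `C ^ 2 * 8 ^ d * m` points of the boundary.
  set m := ((vertexBoundary Γ Ω).card : ℝ) / (((k + 1 : ℕ) : ℝ) * (C ^ 2 * 8 ^ d))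
  have hm : 1 < m := (one_lt_div hKM).2 hk
  obtain ⟨f, -, hfE, hfm, hff, -⟩ := exists_disjoint_testFunctions hΓ (by omega) hC hfin hlow hvol
    (fun p => adj_of_mem_boundaryPairs (Γ := Γ) (Ω := Ω)) hΔ (vertexBoundary Γ Ω) hm (k + 1)
    (by
      rw [← mul_assoc]
      exact (mul_div_cancel₀ _ hKM.ne').le)
  refine subgraphSteklovEigenvalue_le_of_disjoint hΩ hkB (by linarith) f hff (fun i hi => ?_)
    fun i hi => ?_
  · refine (sum_sq_le_pairEnergy _ hd (f i)).trans ?_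
    refine mul_le_mul_of_nonneg_left ?_ (by positivity)
    exact Real.rpow_le_rpow (Finset.sum_nonneg fun p _ => by positivity) (hfE i hi)
      (by positivity)
  · refine (hfm i hi).trans (le_of_eq ?_)
    rw [← Set.ncard_coe_finset]
    congr 2
    ext; simp

/-- The exponents: `|Ω| ^ (1 - 2 / d) / |B|` is of order `|B| ^ (-1 / (d - 1))` by the
isoperimetric inequality. -/
lemma rpow_div_le_of_isoperimetric {d : ℕ} (hd : 2 ≤ d) {I w b N Δ : ℝ} (hI : 1 ≤ I) (hw : 0 ≤ w)
    (hb : 1 ≤ b) (hN0 : 0 ≤ N) (hΔ : 0 ≤ Δ) (hiso : w ^ (d - 1) ≤ I * b ^ d)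
    (hN : N ≤ Δ * (w + b)) :
    N ^ (1 - 2 / (d : ℝ)) / b ≤
      (Δ * (I + 1)) ^ (1 - 2 / (d : ℝ)) * (1 / b ^ (1 / ((d : ℝ) - 1))) := by
  have hd2 : (2 : ℝ) ≤ d := by exact_mod_cast hd
  have hd1 : (0 : ℝ) < d - 1 := by linarith
  have hb0 : 0 < b := by linarith
  have hw1 : w ≤ I * b ^ ((d : ℝ) / (d - 1)) := by
    have h1 := Real.rpow_le_rpow (by positivity) hiso (z := 1 / ((d : ℝ) - 1)) (by positivity)
    rw [← Real.rpow_natCast, ← Real.rpow_mul hw, Nat.cast_sub (by omega), Nat.cast_one,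
      mul_one_div_cancel hd1.ne', Real.rpow_one, Real.mul_rpow (by linarith) (by positivity),
      ← Real.rpow_natCast, ← Real.rpow_mul hb0.le, mul_one_div] at h1
    refine h1.trans (mul_le_mul_of_nonneg_right ?_ (by positivity))
    refine Real.rpow_le_self_of_one_le hI ?_
    rw [div_le_one hd1]
    linarith
  have hb1 : b ≤ b ^ ((d : ℝ) / (d - 1)) := by
    refine Real.self_le_rpow_of_one_le hb ?_
    rw [one_le_div hd1]
    linarith
  have hN1 : N ≤ Δ * (I + 1) * b ^ ((d : ℝ) / (d - 1)) := by
    refine hN.trans ?_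
    rw [mul_assoc]
    refine mul_le_mul_of_nonneg_left ?_ hΔ
    linarith
  have he : 0 ≤ 1 - 2 / (d : ℝ) := by
    rw [sub_nonneg, div_le_one (by linarith)]
    exact hd2
  have h2 := Real.rpow_le_rpow hN0 hN1 he
  rw [Real.mul_rpow (by positivity) (by positivity), ← Real.rpow_mul hb0.le] at h2
  have hexp : (d : ℝ) / (d - 1) * (1 - 2 / d) = 1 - 1 / ((d : ℝ) - 1) := by
    field_simp
    ring
  rw [hexp, Real.rpow_sub hb0, Real.rpow_one] at h2
  rw [div_le_iff₀ hb0]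
  refine h2.trans_eq ?_
  ring

theorem mainTheorem1 {G : Type*} [Group G] (S : Finset G)
    (hsymm : ∀ s ∈ S, s⁻¹ ∈ S) (hone : (1 : G) ∉ S)
    (hgen : Subgroup.closure (S : Set G) = ⊤)
    (d : ℕ) (hd : 2 ≤ d) (hgrowth : HasPolynomialGrowth S d) :
    ∃ C : ℝ, 0 < C ∧
      ∀ Ω : Finset G,
        ((SimpleGraph.mulCayley (S : Set G)).induce (Ω : Set G)).Connected →
        ∀ k : ℕ, k < (vertexBoundary (SimpleGraph.mulCayley (S : Set G)) Ω).card →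
          subgraphSteklovEigenvalue (SimpleGraph.mulCayley (S : Set G)) Ω k ≤
            C * (1 / ((vertexBoundary (SimpleGraph.mulCayley (S : Set G)) Ω).card : ℝ) ^
                (1 / ((d : ℝ) - 1))) *
              (k : ℝ) ^ (((d : ℝ) + 2) / (d : ℝ)) := by
  obtain ⟨C, hC, hgrowth⟩ := hgrowth
  have hd2 : (2 : ℝ) ≤ d := by exact_mod_cast hd
  have hC0 : 0 < C := by linarith
  have hΓ := mulCayley_connected hgen
  set Γ := SimpleGraph.mulCayley (S : Set G)
  have hlow : ∀ x (n : ℕ), 1 ≤ n → C⁻¹ * (n : ℝ) ^ d ≤ ({y | Γ.dist x y ≤ n}.ncard : ℝ) :=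
    fun x n hn => by rw [mulCayley_ncard_ball hΓ]; exact (hgrowth n hn).1
  have hvol : ∀ x (n : ℕ), 1 ≤ n → ({y | Γ.dist x y ≤ n}.ncard : ℝ) ≤ C * (n : ℝ) ^ d :=
    fun x n hn => by rw [mulCayley_ncard_ball hΓ]; exact (hgrowth n hn).2
  -- The lower growth bound excludes the value `0` of `Set.ncard` at infinite sets.
  have hfin : ∀ x (n : ℕ), {y | Γ.dist x y ≤ n}.Finite := by
    intro x n
    refine Set.Finite.subset (s := {y | Γ.dist x y ≤ n + 1}) ?_ fun y hy => Nat.le_succ_of_le hy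
    refine Set.finite_of_ncard_pos (Nat.cast_pos (α := ℝ) |>.1 ?_)
    exact lt_of_lt_of_le (by positivity) (hlow x (n + 1) (by omega))
  set M := C ^ 2 * 8 ^ d
  have hM1 : 1 ≤ M :=
    one_le_mul_of_one_le_of_one_le (one_le_pow₀ hC) (one_le_pow₀ (by norm_num))
  set I := 2 * C * 4 ^ d
  have hI : 1 ≤ I :=
    one_le_mul_of_one_le_of_one_le (by linarith) (one_le_pow₀ (by norm_num))
  set c₁ := ((S.card : ℝ) * (I + 1)) ^ (1 - 2 / (d : ℝ))
  set c₂ := ((S.card : ℝ) * (C * 3 ^ d)) ^ (2 / (d : ℝ))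
  have hc₁ : 0 ≤ c₁ := by positivity
  have hc₂ : 0 ≤ c₂ := by positivity
  set q := ((d : ℝ) + 2) / d
  have hq : 1 ≤ q := by
    rw [one_le_div (by linarith)]
    linarith
  refine ⟨c₁ * c₂ * M * 2 ^ q + 4 * S.card * M + 1, by positivity, fun Ω hΩ k hk => ?_⟩
  rcases Nat.eq_zero_or_pos k with rfl | hk0
  · refine (subgraphSteklovEigenvalue_zero_le hΩ hk).trans (by positivity)
  have hk1 : (1 : ℝ) ≤ k := by exact_mod_cast hk0
  have hK : ((k + 1 : ℕ) : ℝ) ≤ 2 * k := by push_cast; linarith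
  have hP : ∀ p ∈ boundaryPairs Γ Ω, Γ.Adj p.1 p.2 := fun p => adj_of_mem_boundaryPairs
  have hΔ := mulCayley_ncard_fiber_le hsymm hP
  have hb1 : (1 : ℝ) ≤ (vertexBoundary Γ Ω).card := Nat.one_le_cast.2 (Nat.zero_lt_of_lt hk)
  rcases le_or_gt ((vertexBoundary Γ Ω).card : ℝ) (((k + 1 : ℕ) : ℝ) * M) with hsmall | hlarge
  · have hΔ' : ∀ x, {p ∈ (boundaryPairs Γ Ω : Set (G × G)) | p.2 = x}.ncard ≤ S.card := by
      classical
      intro x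
      have hP' : ∀ p ∈ (boundaryPairs Γ Ω).image Prod.swap, Γ.Adj p.1 p.2 := by
        intro p hp
        obtain ⟨p', hp', rfl⟩ := Finset.mem_image.1 hp
        exact (hP p' hp').symm
      refine le_trans ?_ (mulCayley_ncard_fiber_le hsymm hP' x)
      refine Set.ncard_le_ncard_of_injOn Prod.swap ?_ Prod.swap_injective.injOn
        (Finset.finite_toSet _ |>.subset (Set.sep_subset _ _))
      rintro p ⟨hp, hpx⟩
      exact ⟨Finset.mem_coe.2 (Finset.mem_image_of_mem _ hp), hpx⟩
    refine (subgraphSteklovEigenvalue_le_degree hΩ hk hΔ hΔ').trans ?_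
    set b := ((vertexBoundary Γ Ω).card : ℝ)
    have hb : b ^ (1 / ((d : ℝ) - 1)) ≤ 2 * M * (k : ℝ) ^ q := by
      calc b ^ (1 / ((d : ℝ) - 1)) ≤ b := by
            refine Real.rpow_le_self_of_one_le hb1 ?_
            rw [div_le_one (by linarith)]
            linarith
        _ ≤ 2 * k * M := hsmall.trans (mul_le_mul_of_nonneg_right hK (by linarith))
        _ = 2 * M * k := by ring
        _ ≤ 2 * M * (k : ℝ) ^ q :=
            mul_le_mul_of_nonneg_left (Real.self_le_rpow_of_one_le hk1 hq) (by positivity)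
    have hbpos : 0 < b ^ (1 / ((d : ℝ) - 1)) := by positivity
    rw [mul_one_div, div_mul_eq_mul_div, le_div_iff₀ hbpos]
    calc 2 * (S.card : ℝ) * b ^ (1 / ((d : ℝ) - 1)) ≤ 2 * S.card * (2 * M * (k : ℝ) ^ q) :=
          mul_le_mul_of_nonneg_left hb (by positivity)
      _ = 4 * S.card * M * (k : ℝ) ^ q := by ring
      _ ≤ _ := mul_le_mul_of_nonneg_right
          (by linarith [show 0 ≤ c₁ * c₂ * M * 2 ^ q by positivity]) (by positivity)
  · have hΩne : Ω.Nonempty := by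
      obtain ⟨x⟩ := hΩ.nonempty
      exact ⟨x.1, x.2⟩
    have hiso := card_pow_le_card_vertexBoundary_pow hΓ (by omega) hC (hfin 1) (hlow 1) Ω hΩne
    have hN : ((boundaryPairs Γ Ω).card : ℝ) ≤
        S.card * (Ω.card + (vertexBoundary Γ Ω).card) := by
      exact_mod_cast card_boundaryPairs_le hΔ
    have hmain := rpow_div_le_of_isoperimetric hd hI (Nat.cast_nonneg _) hb1 (Nat.cast_nonneg _)
      (Nat.cast_nonneg _) hiso hN
    refine (subgraphSteklovEigenvalue_le_of_growth hΓ hd hC hfin hlow hvol hΩ hΔ hlarge).trans ?_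
    set b := ((vertexBoundary Γ Ω).card : ℝ)
    set N := ((boundaryPairs Γ Ω).card : ℝ)
    set K : ℝ := ((k + 1 : ℕ) : ℝ)
    have hK0 : 0 < K := by positivity
    have hb0 : 0 < b := by linarith
    have hKq : K ^ (2 / (d : ℝ)) * K = K ^ q := by
      rw [← Real.rpow_add_one hK0.ne']
      congr 1
      simp only [q]
      field_simp
      ring
    calc N ^ (1 - 2 / (d : ℝ)) * (K * (S.card * (C * 3 ^ d))) ^ (2 / (d : ℝ)) / (b / (K * M))
        = N ^ (1 - 2 / (d : ℝ)) / b * (c₂ * M * K ^ q) := by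
          rw [Real.mul_rpow hK0.le (by positivity), ← hKq]
          change N ^ _ * (K ^ _ * c₂) / _ = _
          rw [div_div_eq_mul_div]
          ring
      _ ≤ c₁ * (1 / b ^ (1 / ((d : ℝ) - 1))) * (c₂ * M * (2 ^ q * (k : ℝ) ^ q)) := by
          refine mul_le_mul hmain (mul_le_mul_of_nonneg_left ?_ (by positivity)) (by positivity)
            (by positivity)
          rw [← Real.mul_rpow two_pos.le (by positivity)]
          exact Real.rpow_le_rpow hK0.le hK (by linarith)
      _ = c₁ * c₂ * M * 2 ^ q * (1 / b ^ (1 / ((d : ℝ) - 1))) * (k : ℝ) ^ q := by ring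
      _ ≤ _ := by
          refine mul_le_mul_of_nonneg_right (mul_le_mul_of_nonneg_right ?_ (by positivity))
            (by positivity)
          linarith [show 0 ≤ 4 * (S.card : ℝ) * M by positivity]
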